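/- Graphs are finite and undirected and may have parallel edges and loops. For a graph $G$ let $c(G)$ be its number of connected components. For a real number $t$, $G$ is $t$-tough if $|S|\ge t\cdot c(G-S)$ for every $S\subseteq V(G)$ with $c(G-S)>1$. The toughness $\tau(G)$ is the largest $t$ for which $G$ is $t$-tough, with $\tau(G)=\infty$ if no set $S\subseteq V(G)$ satisfies $c(G-S)>1$ (as for complete graphs). $G$ is minimally $t$-tough if $\tau(G)=t$ and $\tau(G-e)<t$ for every edge $e$ of $G$. A series–parallel graph with terminals $a\ne b$ is either a single edge joining $a$ and $b$, or is obtained from two or more series–parallel graphs $G_1(a_1,b_1),\dots,G_k(a_k,b_k)$ by a series join (identify $b_i$ with $a_{i+1}$ for $1\le i<k$; the new terminals are $a_1$ and $b_k$) or a parallel join (identify all $a_i$ to one terminal $a$ and all $b_i$ to one terminal $b$). Theorem. Let $t\ge \frac12$ be a real number and let $G$ be a minimally $t$-tough series–parallel graph. Then $G$ has a vertex of degree $\lceil 2t\rceil$ (the Generalized Kriesell conjecture for these graphs). Moreover $t\le 1$, that is, there is no minimally $t$-tough series–parallel graph with $t>1$. -/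

import Mathlib

namespace Graph

open scoped Graph

variable {α β : Type*}

/-- The degree of a vertex in a multigraph: the number of incident edges, a loop counting twice. -/
noncomputable def degree (G : Graph α β) (v : α) : ℕ :=
  (G.incidenceSet v).ncard + (G.loopSet v).ncard

/-- The number `c(G)` of connected components of a finite multigraph. Loops and multiplicities of
edges play no role for connectivity, so the components are those of the underlying simple graph on
the vertex set `V(G)`. The graph without vertices has no component. -/
noncomputable def numComponents (G : Graph α β) : ℕ :=
  Nat.card G.toSimpleGraph.ConnectedComponent

/-- `G` is `t`-tough if `|S| ≥ t · c(G - S)` for every `S ⊆ V(G)` with `c(G - S) > 1`. -/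
def IsTough (G : Graph α β) (t : ℝ) : Prop :=
  ∀ S : Set α, S ⊆ V(G) → 1 < (G.deleteVerts S).numComponents →
    t * ((G.deleteVerts S).numComponents : ℝ) ≤ (S.ncard : ℝ)

/-- The toughness of `G`: the largest `t` for which `G` is `t`-tough, and `∞` if there is no largest
one because no vertex set `S` leaves more than one component (as for complete graphs). -/
noncomputable def toughness (G : Graph α β) : EReal :=
  sSup {x : EReal | ∃ t : ℝ, x = (t : EReal) ∧ G.IsTough t}

/-- `G` is minimally `t`-tough if its toughness is `t` and the deletion of any edge decreases the
toughness. -/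
def IsMinimallyTough (G : Graph α β) (t : ℝ) : Prop :=
  G.toughness = (t : EReal) ∧ ∀ e ∈ E(G), (G.deleteEdges {e}).toughness < (t : EReal)

/-- `G` is the union of `G₁` and `G₂`, which have no common edge (but may share vertices). -/
structure IsEdgeDisjointUnion (G G₁ G₂ : Graph α β) : Prop where
  vertexSet_eq : V(G) = V(G₁) ∪ V(G₂)
  disjoint_edgeSet : Disjoint E(G₁) E(G₂)
  isLink_iff : ∀ e x y, G.IsLink e x y ↔ G₁.IsLink e x y ∨ G₂.IsLink e x y

/-- `G` is a series-parallel graph with terminals `s` and `t`: a single edge joining two distinct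
vertices `s` and `t`, or a series join or a parallel join of two series-parallel graphs. Gluing two
graphs along terminals is expressed by two subgraphs of the result that have precisely the
identified terminals in common. Joins of more than two graphs are iterated binary joins. -/
inductive IsSeriesParallelWith : Graph α β → α → α → Prop
  | edge (e : β) (s t : α) (hst : s ≠ t) : IsSeriesParallelWith (banana s t {e}) s t
  | series (G G₁ G₂ : Graph α β) (s m t : α)
      (h₁ : IsSeriesParallelWith G₁ s m) (h₂ : IsSeriesParallelWith G₂ m t)
      (hV : V(G₁) ∩ V(G₂) = {m}) (hG : IsEdgeDisjointUnion G G₁ G₂) :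
      IsSeriesParallelWith G s t
  | parallel (G G₁ G₂ : Graph α β) (s t : α)
      (h₁ : IsSeriesParallelWith G₁ s t) (h₂ : IsSeriesParallelWith G₂ s t)
      (hV : V(G₁) ∩ V(G₂) = {s, t}) (hG : IsEdgeDisjointUnion G G₁ G₂) :
      IsSeriesParallelWith G s t

/-- `G` is a series-parallel graph (for some choice of the two terminals). -/
def IsSeriesParallel (G : Graph α β) : Prop :=
  ∃ s t : α, G.IsSeriesParallelWith s t

end Graph

/-!
The case `t > 1 / 2` is a degree argument. The two parts of an innermost join of a series-parallel
graph are single edges, so the graph is an edge, has parallel edges, or has an inner vertex of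
degree `2` (`IsSeriesParallelWith.exists_isInnerDegreeTwo`). An edge has infinite toughness and
deleting one of two parallel edges leaves the toughness unchanged, so a minimally tough graph has
such a vertex; deleting its neighbours shows `t ≤ 1`, and `⌈2t⌉ = 2`.

For `t = 1 / 2` a terminal has degree `1`. Write `f(S) = c(G - S) - 2 |S|`. Toughness says
`f(S) ≤ 0` for `S ≠ ∅`, with equality for the tight sets, and minimality says that every edge is a
bridge of `G - S` for `S = ∅` or for some tight `S`. Cut `G` along two vertices into `H` and its
complement `R`. Then `f` is, up to a correction depending only on the terminals, the sum of a value
for `H` and a value for `R`, and the two may be chosen independently once it is known which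
terminals are deleted and, if none is, whether they stay connected. The set of all possible data is
the *profile* of a two-terminal graph; profiles of joins are computed from those of the parts
(`IsJoin.profile_series`, `IsJoin.profile_parallel`), and the complements of the parts of `G` are
again joins (`Profile.total_series_left`, `Profile.parallel_assoc`).

Call `H` light if in all its parts deleting one terminal with other vertices has value at most `1`.
Following a light parallel join down to its leftmost and its rightmost edge, the tight sets of
these edges show that the complement has value at least `2` when only the right, respectively only
the left, terminal is deleted (`SPTree.Light.parallel_right`, `SPTree.Light.parallel_left`). From
this every part whose terminals are connected in the complement is light
(`SPTree.light_of_conn`). Now let `H` be the leftmost part of `G` along series joins. If it were a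
parallel join, it would be light, so its complement, in which the left terminal `s` is isolated,
would have value at least `2` with only `s` deleted; keeping `s` instead adds a component and
violates toughness (`SPTree.leftEdge_of_crit`). Hence `H` is an edge and `s` has degree `1`.
-/

namespace Graph

/-! ### Profiles of two-terminal graphs -/

/-- A profile records the possible effects of deleting a vertex set `S` from a two-terminal graph
`H` with terminals `s` and `t`. `P a b c n v` says that some `S` has `a ↔ s ∈ S`, `b ↔ t ∈ S`,
`c ↔ s` and `t` both survive in one component of `H - S`, `n ↔ S` contains a vertex that is not a
terminal, and `v = c(H - S) - 2 |S \ {s, t}|`. Deleted terminals are not charged here, so that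
the values of graphs glued along terminals add up. -/
abbrev Profile := Bool → Bool → Bool → Bool → ℤ → Prop

namespace Profile

/-- The profile of a single edge joining the terminals. -/
def single : Profile := fun a b c n v ↦
  n = false ∧ c = (!a && !b) ∧ v = if a && b then 0 else 1

/-- The profile of two isolated terminals. -/
def isolated : Profile := fun a b c n v ↦
  n = false ∧ c = false ∧ v = (if a then 0 else 1) + (if b then 0 else 1)

/-- The profile of a series join: the joining vertex, if kept, is counted twice; if deleted, it
costs `2`. -/
def series (P Q : Profile) : Profile := fun a b c n v ↦
  ∃ m c₁ n₁ v₁ c₂ n₂ v₂, P a m c₁ n₁ v₁ ∧ Q m b c₂ n₂ v₂ ∧ c = (!m && c₁ && c₂) ∧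
    n = (m || n₁ || n₂) ∧ v = v₁ + v₂ - if m then 2 else 1

/-- How many components are lost when two graphs are glued along both terminals. -/
def parLoss (a b c₁ c₂ : Bool) : ℤ :=
  if a && b then 0 else if a || b || (c₁ && c₂) then 1 else 2

/-- The profile of a parallel join. -/
def parallel (P Q : Profile) : Profile := fun a b c n v ↦
  ∃ c₁ n₁ v₁ c₂ n₂ v₂, P a b c₁ n₁ v₁ ∧ Q a b c₂ n₂ v₂ ∧ c = (c₁ || c₂) ∧
    n = (n₁ || n₂) ∧ v = v₁ + v₂ - parLoss a b c₁ c₂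

/-- The profile with the two terminals exchanged. -/
def rev (P : Profile) : Profile := fun a b c n v ↦ P b a c n v

/-- `P.Total n v`: some vertex set `S`, nonempty iff `n`, has `c(H - S) - 2 |S| = v`, deleted
terminals now being charged. -/
def Total (P : Profile) (n : Bool) (v : ℤ) : Prop :=
  ∃ a b c n' w, P a b c n' w ∧ n = (a || b || n') ∧
    v = w - (if a then 2 else 0) - (if b then 2 else 0)

/-- The parallel join of `P` and `R` is connected and `1/2`-tough. In terms of values this means
`c(G) = 1` and `c(G - S) ≤ 2 |S|` for every nonempty `S`. -/
def Tough (P R : Profile) : Prop :=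
  ∀ n v, (P.parallel R).Total n v → (n = true → v ≤ 0) ∧ (n = false → v = 1)

/-- The terminals are connected as long as nothing is deleted. -/
def Conn (R : Profile) : Prop := ∀ c v, R false false c false v → c = true

end Profile

open Profile

/-- Series-parallel decomposition trees. -/
inductive SPTree : Type
  | edge : SPTree
  | series : SPTree → SPTree → SPTree
  | parallel : SPTree → SPTree → SPTree

namespace SPTree

/-- The profile of the graph described by a decomposition tree. -/
def profile : SPTree → Profile
  | edge => single
  | series A B => A.profile.series B.profile
  | parallel A B => A.profile.parallel B.profile

/-- `OneDel T P`: `P` is the profile of the graph described by `T` after one edge is deleted. -/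
inductive OneDel : SPTree → Profile → Prop
  | edge : OneDel edge isolated
  | seriesLeft (A B : SPTree) (P : Profile) (h : OneDel A P) :
      OneDel (series A B) (P.series B.profile)
  | seriesRight (A B : SPTree) (P : Profile) (h : OneDel B P) :
      OneDel (series A B) (A.profile.series P)
  | parallelLeft (A B : SPTree) (P : Profile) (h : OneDel A P) :
      OneDel (parallel A B) (P.parallel B.profile)
  | parallelRight (A B : SPTree) (P : Profile) (h : OneDel B P) :
      OneDel (parallel A B) (A.profile.parallel P)

/-- In the parallel join of `T` with a graph of profile `R`, the deletion of any edge of `T`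
destroys `1/2`-toughness: afterwards some `S` leaves at least two components and more than
`2 |S|` of them. -/
def Crit (T : SPTree) (R : Profile) : Prop :=
  ∀ P, OneDel T P → ∃ n v, (P.parallel R).Total n v ∧ 1 ≤ v ∧ (n = false → 2 ≤ v)

/-- `T` is light if, in every part of `T`, no vertex set containing exactly one of the two terminals
has value above `1`, the value of that terminal alone. Only series joins need to be constrained:
edges satisfy the condition, and parallel joins inherit it (`Light.left_le`, `Light.right_le`). -/
def Light : SPTree → Prop
  | edge => True
  | series A B => A.Light ∧ B.Light ∧
      (∀ c n v, (A.series B).profile true false c n v → v ≤ 1) ∧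
      (∀ c n v, (A.series B).profile false true c n v → v ≤ 1)
  | parallel A B => A.Light ∧ B.Light

/-- The leftmost part of the tree along series joins is a single edge. -/
def LeftEdge : SPTree → Prop
  | edge => True
  | series A _ => A.LeftEdge
  | parallel _ _ => False

end SPTree

/-! ### Re-association of joins -/

namespace Profile

theorem parallel_comm (P Q : Profile) : P.parallel Q = Q.parallel P := by
  funext a b c n v
  apply propext
  constructor
  all_goals
    rintro ⟨c₁, n₁, v₁, c₂, n₂, v₂, h₁, h₂, rfl, rfl, rfl⟩
    refine ⟨c₂, n₂, v₂, c₁, n₁, v₁, h₂, h₁, Bool.or_comm _ _, Bool.or_comm _ _, ?_⟩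
    simp only [parLoss, Bool.and_comm c₂ c₁]
    ring

theorem parallel_assoc (P Q R : Profile) :
    (P.parallel Q).parallel R = P.parallel (Q.parallel R) := by
  funext a b c n v
  apply propext
  constructor
  · rintro ⟨_, _, _, c₃, n₃, v₃, ⟨c₁, n₁, v₁, c₂, n₂, v₂, h₁, h₂, rfl, rfl, rfl⟩, h₃, rfl, rfl, rfl⟩
    refine ⟨_, _, _, _, _, _, h₁, ⟨_, _, _, _, _, _, h₂, h₃, rfl, rfl, rfl⟩,
      Bool.or_assoc _ _ _, Bool.or_assoc _ _ _, ?_⟩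
    cases a <;> cases b <;> cases c₁ <;> cases c₂ <;> cases c₃ <;> simp [parLoss] <;> ring
  · rintro ⟨c₁, n₁, v₁, _, _, _, h₁, ⟨c₂, n₂, v₂, c₃, n₃, v₃, h₂, h₃, rfl, rfl, rfl⟩, rfl, rfl, rfl⟩
    refine ⟨_, _, _, _, _, _, ⟨_, _, _, _, _, _, h₁, h₂, rfl, rfl, rfl⟩, h₃,
      (Bool.or_assoc _ _ _).symm, (Bool.or_assoc _ _ _).symm, ?_⟩
    cases a <;> cases b <;> cases c₁ <;> cases c₂ <;> cases c₃ <;> simp [parLoss] <;> ring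

/-- Closing a series join `P Q` by `R` gives a cycle of three two-terminal graphs, which is also
`P` closed by the series join of `R` and `Q`. -/
theorem total_series_left (P Q R : Profile) (n : Bool) (v : ℤ) :
    ((P.series Q).parallel R).Total n v ↔ (P.parallel (R.series Q.rev)).Total n v := by
  constructor
  · rintro ⟨a, b, _, _, _, ⟨_, _, _, c₃, n₃, v₃, ⟨m, c₁, n₁, v₁, c₂, n₂, v₂, h₁, h₂, rfl, rfl, rfl⟩,
      h₃, rfl, rfl, rfl⟩, rfl, rfl⟩
    refine ⟨a, m, _, _, _, ⟨_, _, _, _, _, _, h₁, ⟨b, _, _, _, _, _, _, h₃, h₂, rfl, rfl, rfl⟩,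
      rfl, rfl, rfl⟩, ?_, ?_⟩
    · cases a <;> cases b <;> cases m <;> cases n₁ <;> cases n₂ <;> cases n₃ <;> rfl
    · cases a <;> cases b <;> cases m <;> cases c₁ <;> cases c₂ <;> cases c₃ <;>
        simp [parLoss] <;> ring
  · rintro ⟨a, m, _, _, _, ⟨c₁, n₁, v₁, _, _, _, h₁, ⟨b, c₃, n₃, v₃, c₂, n₂, v₂, h₃, h₂, rfl, rfl,
      rfl⟩, rfl, rfl, rfl⟩, rfl, rfl⟩
    refine ⟨a, b, _, _, _, ⟨_, _, _, _, _, _, ⟨m, _, _, _, _, _, _, h₁, h₂, rfl, rfl, rfl⟩, h₃,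
      rfl, rfl, rfl⟩, ?_, ?_⟩
    · cases a <;> cases b <;> cases m <;> cases n₁ <;> cases n₂ <;> cases n₃ <;> rfl
    · cases a <;> cases b <;> cases m <;> cases c₁ <;> cases c₂ <;> cases c₃ <;>
        simp [parLoss] <;> ring

theorem total_series_right (P Q R : Profile) (n : Bool) (v : ℤ) :
    ((P.series Q).parallel R).Total n v ↔ (Q.parallel (P.rev.series R)).Total n v := by
  constructor
  · rintro ⟨a, b, _, _, _, ⟨_, _, _, c₃, n₃, v₃, ⟨m, c₁, n₁, v₁, c₂, n₂, v₂, h₁, h₂, rfl, rfl, rfl⟩,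
      h₃, rfl, rfl, rfl⟩, rfl, rfl⟩
    refine ⟨m, b, _, _, _, ⟨_, _, _, _, _, _, h₂, ⟨a, _, _, _, _, _, _, h₁, h₃, rfl, rfl, rfl⟩,
      rfl, rfl, rfl⟩, ?_, ?_⟩
    · cases a <;> cases b <;> cases m <;> cases n₁ <;> cases n₂ <;> cases n₃ <;> rfl
    · cases a <;> cases b <;> cases m <;> cases c₁ <;> cases c₂ <;> cases c₃ <;>
        simp [parLoss] <;> ring
  · rintro ⟨m, b, _, _, _, ⟨c₂, n₂, v₂, _, _, _, h₂, ⟨a, c₁, n₁, v₁, c₃, n₃, v₃, h₁, h₃, rfl, rfl,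
      rfl⟩, rfl, rfl, rfl⟩, rfl, rfl⟩
    refine ⟨a, b, _, _, _, ⟨_, _, _, _, _, _, ⟨m, _, _, _, _, _, _, h₁, h₂, rfl, rfl, rfl⟩, h₃,
      rfl, rfl, rfl⟩, ?_, ?_⟩
    · cases a <;> cases b <;> cases m <;> cases n₁ <;> cases n₂ <;> cases n₃ <;> rfl
    · cases a <;> cases b <;> cases m <;> cases c₁ <;> cases c₂ <;> cases c₃ <;>
        simp [parLoss] <;> ring

/-- The bound that toughness gives for a pair of selections. -/
theorem Tough.le {P R : Profile} (h : P.Tough R) {a b c₁ n₁ c₂ n₂ : Bool} {v₁ v₂ : ℤ}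
    (h₁ : P a b c₁ n₁ v₁) (h₂ : R a b c₂ n₂ v₂) :
    ((a || b || (n₁ || n₂)) = true → v₁ + v₂ ≤
      parLoss a b c₁ c₂ + (if a then 2 else 0) + (if b then 2 else 0)) ∧
    ((a || b || (n₁ || n₂)) = false → v₁ + v₂ = parLoss a b c₁ c₂ + 1) := by
  obtain ⟨h₃, h₄⟩ := h _ _ ⟨a, b, _, _, _, ⟨_, _, _, _, _, _, h₁, h₂, rfl, rfl, rfl⟩, rfl, rfl⟩
  refine ⟨fun hn ↦ ?_, fun hn ↦ ?_⟩
  · have := h₃ hn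
    linarith
  · have := h₄ hn
    simp only [Bool.or_eq_false_iff] at hn
    simp only [hn.1.1, hn.1.2] at this ⊢
    simp at this
    linarith

end Profile

namespace SPTree

variable {T A B : SPTree} {R : Profile}

theorem tough_series_left (h : (A.series B).profile.Tough R) :
    A.profile.Tough (R.series B.profile.rev) :=
  fun n v hv ↦ h n v ((total_series_left _ _ _ _ _).2 hv)

theorem tough_series_right (h : (A.series B).profile.Tough R) :
    B.profile.Tough (A.profile.rev.series R) :=
  fun n v hv ↦ h n v ((total_series_right _ _ _ _ _).2 hv)

theorem tough_parallel_left (h : (A.parallel B).profile.Tough R) :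
    A.profile.Tough (B.profile.parallel R) := by
  intro n v hv
  rw [← parallel_assoc] at hv
  exact h n v hv

theorem tough_parallel_right (h : (A.parallel B).profile.Tough R) :
    B.profile.Tough (A.profile.parallel R) := by
  intro n v hv
  rw [← parallel_assoc, parallel_comm B.profile] at hv
  exact h n v hv

theorem Crit.series_left (h : (A.series B).Crit R) : A.Crit (R.series B.profile.rev) := by
  intro P hP
  obtain ⟨n, v, h₁, h₂⟩ := h _ (.seriesLeft _ _ _ hP)
  exact ⟨n, v, (total_series_left _ _ _ _ _).1 h₁, h₂⟩

theorem Crit.series_right (h : (A.series B).Crit R) : B.Crit (A.profile.rev.series R) := by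
  intro P hP
  obtain ⟨n, v, h₁, h₂⟩ := h _ (.seriesRight _ _ _ hP)
  exact ⟨n, v, (total_series_right _ _ _ _ _).1 h₁, h₂⟩

theorem Crit.parallel_left (h : (A.parallel B).Crit R) : A.Crit (B.profile.parallel R) := by
  intro P hP
  obtain ⟨n, v, h₁, h₂⟩ := h _ (.parallelLeft _ _ _ hP)
  rw [parallel_assoc] at h₁
  exact ⟨n, v, h₁, h₂⟩

theorem Crit.parallel_right (h : (A.parallel B).Crit R) : B.Crit (A.profile.parallel R) := by
  intro P hP
  obtain ⟨n, v, h₁, h₂⟩ := h _ (.parallelRight _ _ _ hP)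
  rw [parallel_comm A.profile, parallel_assoc] at h₁
  exact ⟨n, v, h₁, h₂⟩

/-! ### Elementary properties of the profile of a decomposition tree -/

/-- Deleting nothing leaves a series-parallel graph connected. -/
theorem profile_of_empty (T : SPTree) {c : Bool} {v : ℤ} (h : T.profile false false c false v) :
    c = true ∧ v = 1 := by
  induction T generalizing c v with
  | edge => obtain ⟨_, rfl, rfl⟩ := h; simp
  | series A B hA hB =>
    obtain ⟨m, c₁, n₁, v₁, c₂, n₂, v₂, h₁, h₂, rfl, hn, rfl⟩ := h
    simp only [Bool.false_eq, Bool.or_eq_false_iff] at hn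
    obtain ⟨⟨rfl, rfl⟩, rfl⟩ := hn
    obtain ⟨rfl, rfl⟩ := hA h₁
    obtain ⟨rfl, rfl⟩ := hB h₂
    simp
  | parallel A B hA hB =>
    obtain ⟨c₁, n₁, v₁, c₂, n₂, v₂, h₁, h₂, rfl, hn, rfl⟩ := h
    simp only [Bool.false_eq, Bool.or_eq_false_iff] at hn
    obtain ⟨rfl, rfl⟩ := hn
    obtain ⟨rfl, rfl⟩ := hA h₁
    obtain ⟨rfl, rfl⟩ := hB h₂
    simp [parLoss]

theorem profile_empty (T : SPTree) : T.profile false false true false 1 := by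
  induction T with
  | edge => simp [profile, single]
  | series A B hA hB => exact ⟨false, _, _, _, _, _, _, hA, hB, by simp, by simp, by simp⟩
  | parallel A B hA hB => exact ⟨_, _, _, _, _, _, hA, hB, by simp, by simp, by simp [parLoss]⟩

theorem profile_left (T : SPTree) : T.profile true false false false 1 := by
  induction T with
  | edge => simp [profile, single]
  | series A B hA hB =>
    exact ⟨false, _, _, _, _, _, _, hA, B.profile_empty, by simp, by simp, by simp⟩
  | parallel A B hA hB => exact ⟨_, _, _, _, _, _, hA, hB, by simp, by simp, by simp [parLoss]⟩

theorem profile_right (T : SPTree) : T.profile false true false false 1 := by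
  induction T with
  | edge => simp [profile, single]
  | series A B hA hB =>
    exact ⟨false, _, _, _, _, _, _, A.profile_empty, hB, by simp, by simp, by simp⟩
  | parallel A B hA hB => exact ⟨_, _, _, _, _, _, hA, hB, by simp, by simp, by simp [parLoss]⟩

theorem conn_profile (T : SPTree) : T.profile.Conn := fun _ _ h ↦ (T.profile_of_empty h).1

/-! ### Light decomposition trees -/

theorem Light.left_le (h : T.Light) {c n v} (hv : T.profile true false c n v) : v ≤ 1 := by
  induction T generalizing c n v with
  | edge => obtain ⟨_, _, rfl⟩ := hv; simp
  | series A B => exact h.2.2.1 _ _ _ hv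
  | parallel A B hA hB =>
    obtain ⟨c₁, n₁, v₁, c₂, n₂, v₂, h₁, h₂, rfl, hn, rfl⟩ := hv
    have := hA h.1 h₁
    have := hB h.2 h₂
    simp [parLoss]
    omega

theorem Light.right_le (h : T.Light) {c n v} (hv : T.profile false true c n v) : v ≤ 1 := by
  induction T generalizing c n v with
  | edge => obtain ⟨_, _, rfl⟩ := hv; simp
  | series A B => exact h.2.2.2 _ _ _ hv
  | parallel A B hA hB =>
    obtain ⟨c₁, n₁, v₁, c₂, n₂, v₂, h₁, h₂, rfl, hn, rfl⟩ := hv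
    have := hA h.1 h₁
    have := hB h.2 h₂
    simp [parLoss]
    omega

theorem Light.none_le (h : T.Light) {c n v} (hv : T.profile false false c n v) :
    v ≤ 1 ∧ (c = false → v ≤ 0) := by
  induction T generalizing c n v with
  | edge => obtain ⟨_, rfl, rfl⟩ := hv; simp
  | series A B hA hB =>
    obtain ⟨m, c₁, n₁, v₁, c₂, n₂, v₂, h₁, h₂, rfl, hn, rfl⟩ := hv
    cases m
    · have h₃ := hA h.1 h₁
      have h₄ := hB h.2.1 h₂
      cases c₁ <;> cases c₂ <;> simp at * <;> omega
    · have := h.1.right_le h₁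
      have := h.2.1.left_le h₂
      simp
      omega
  | parallel A B hA hB =>
    obtain ⟨c₁, n₁, v₁, c₂, n₂, v₂, h₁, h₂, rfl, hn, rfl⟩ := hv
    have h₃ := hA h.1 h₁
    have h₄ := hB h.2 h₂
    cases c₁ <;> cases c₂ <;> simp [parLoss] at * <;> omega

/-- Only parallel joins among the light trees can leave more than two components per deleted
vertex between deleted terminals. -/
theorem Light.series_both_le (h : (A.series B).Light) {c n v}
    (hv : (A.series B).profile true true c n v) : v ≤ 2 := by
  obtain ⟨m, c₁, n₁, v₁, c₂, n₂, v₂, h₁, h₂, rfl, hn, rfl⟩ := hv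
  cases m
  · have := h.1.left_le h₁
    have := h.2.1.right_le h₂
    simp
    omega
  · have h₃ := h.2.2.2 _ _ _ ⟨true, _, _, _, _, _, _, A.profile_right, h₂, rfl, rfl, rfl⟩
    have h₄ := h.2.2.1 _ _ _ ⟨true, _, _, _, _, _, _, h₁, B.profile_left, rfl, rfl, rfl⟩
    simp at *
    omega

/-! ### Tight sets separating the terminals of a light subgraph -/

/-- If both terminals are kept, a connected complement contributes at most `1`. -/
theorem none_le_of_tough (hR : R.Conn) (ht : T.profile.Tough R) {c n v}
    (hv : R false false c n v) : v ≤ 1 := by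
  have := ht.le T.profile_empty hv
  cases n
  · obtain rfl := hR _ _ hv
    simp [parLoss] at this
    omega
  · cases c <;> simp [parLoss] at this <;> omega

theorem none_le_two_of_tough (ht : T.profile.Tough R) {c n v}
    (hv : R false false c n v) : v ≤ 2 := by
  have := ht.le T.profile_empty hv
  cases n <;> cases c <;> simp [parLoss] at this <;> omega

theorem Crit.edge (ht : edge.profile.Tough R) (hc : edge.Crit R) :
    ∃ n v, R false false false n v ∧ 1 ≤ v := by
  obtain ⟨n, v, ⟨a, b, _, _, _, ⟨c₁, n₁, v₁, c₂, n₂, v₂, h₁, h₂, rfl, rfl, rfl⟩, rfl, rfl⟩,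
    h₃, h₄⟩ := hc _ .edge
  obtain ⟨rfl, rfl, rfl⟩ := h₁
  have h₅ := ht.le (v₁ := if a && b then 0 else 1) ⟨rfl, rfl, rfl⟩ h₂
  cases a <;> cases b <;> cases c₂ <;> cases n₂ <;> simp [parLoss] at h₃ h₄ h₅
  all_goals first | omega | exact ⟨_, _, h₂, by omega⟩

theorem conn_parallel_left (hP : A.profile.Conn) : (A.profile.parallel R).Conn := by
  rintro _ _ ⟨c₁, n₁, v₁, c₂, n₂, v₂, h₁, h₂, rfl, hn, rfl⟩
  simp only [Bool.false_eq, Bool.or_eq_false_iff] at hn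
  obtain ⟨rfl, rfl⟩ := hn
  simp [hP _ _ h₁]

theorem conn_series_rev (hR : R.Conn) : (R.series B.profile.rev).Conn := by
  rintro _ _ ⟨m, c₁, n₁, v₁, c₂, n₂, v₂, h₁, h₂, rfl, hn, rfl⟩
  simp only [Bool.false_eq, Bool.or_eq_false_iff] at hn
  obtain ⟨⟨rfl, rfl⟩, rfl⟩ := hn
  simp [hR _ _ h₁, B.conn_profile _ _ h₂]

theorem conn_rev_series (hR : R.Conn) : (A.profile.rev.series R).Conn := by
  rintro _ _ ⟨m, c₁, n₁, v₁, c₂, n₂, v₂, h₁, h₂, rfl, hn, rfl⟩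
  simp only [Bool.false_eq, Bool.or_eq_false_iff] at hn
  obtain ⟨⟨rfl, rfl⟩, rfl⟩ := hn
  simp [hR _ _ h₂, A.conn_profile _ _ h₁]

/-- The inductive step of `Light.exists_tight_right` at a parallel join, where the complement need
not be connected. -/
theorem Light.exists_right_of_parallel (h : (A.parallel B).Light)
    (ht : (A.parallel B).profile.Tough R)
    (hA : (∃ c n v, (B.profile.parallel R) false true c n v ∧ 2 ≤ v) ∨
      ∃ n v, (B.profile.parallel R) false false false n v ∧ 1 ≤ v) :
    ∃ c n v, R false true c n v ∧ 2 ≤ v := by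
  rcases hA with ⟨_, _, _, ⟨c₁, n₁, v₁, c₂, n₂, v₂, h₁, h₂, rfl, rfl, rfl⟩, hv⟩ |
    ⟨_, _, ⟨c₁, n₁, v₁, c₂, n₂, v₂, h₁, h₂, hc, rfl, rfl⟩, hv⟩
  · have := h.2.right_le h₁
    exact ⟨_, _, _, h₂, by simp [parLoss] at hv; omega⟩
  · simp only [Bool.false_eq, Bool.or_eq_false_iff] at hc
    obtain ⟨rfl, rfl⟩ := hc
    have := (h.2.none_le h₁).2 rfl
    have := none_le_two_of_tough ht h₂
    simp [parLoss] at hv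
    omega

theorem Light.exists_left_of_parallel (h : (A.parallel B).Light)
    (ht : (A.parallel B).profile.Tough R)
    (hA : (∃ c n v, (B.profile.parallel R) true false c n v ∧ 2 ≤ v) ∨
      ∃ n v, (B.profile.parallel R) false false false n v ∧ 1 ≤ v) :
    ∃ c n v, R true false c n v ∧ 2 ≤ v := by
  rcases hA with ⟨_, _, _, ⟨c₁, n₁, v₁, c₂, n₂, v₂, h₁, h₂, rfl, rfl, rfl⟩, hv⟩ |
    ⟨_, _, ⟨c₁, n₁, v₁, c₂, n₂, v₂, h₁, h₂, hc, rfl, rfl⟩, hv⟩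
  · have := h.2.left_le h₁
    exact ⟨_, _, _, h₂, by simp [parLoss] at hv; omega⟩
  · simp only [Bool.false_eq, Bool.or_eq_false_iff] at hc
    obtain ⟨rfl, rfl⟩ := hc
    have := (h.2.none_le h₁).2 rfl
    have := none_le_two_of_tough ht h₂
    simp [parLoss] at hv
    omega

/-- Follow a light tree down to its leftmost edge. A set witnessing that this edge is critical
keeps the left terminal, and on the complement it either deletes the right terminal and has the
extremal value `2`, or it separates the two terminals. -/
theorem Light.exists_tight_right (h : T.Light) (hR : R.Conn) (ht : T.profile.Tough R)
    (hc : T.Crit R) :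
    (∃ c n v, R false true c n v ∧ 2 ≤ v) ∨ ∃ n v, R false false false n v ∧ 1 ≤ v := by
  induction T generalizing R with
  | edge => exact .inr (hc.edge ht)
  | parallel A B hA hB =>
    exact .inl (h.exists_right_of_parallel ht (hA h.1 (conn_parallel_left B.conn_profile)
      (tough_parallel_left ht) hc.parallel_left))
  | series A B hA hB =>
    rcases hA h.1 (conn_series_rev hR) (tough_series_left ht) hc.series_left with
      ⟨_, _, _, ⟨m, c₁, n₁, v₁, c₂, n₂, v₂, h₁, h₂, rfl, rfl, rfl⟩, hv⟩ |
      ⟨_, _, ⟨m, c₁, n₁, v₁, c₂, n₂, v₂, h₁, h₂, hc', rfl, rfl⟩, hv⟩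
    · cases m
      · have := none_le_of_tough hR ht h₁
        have := h.2.1.left_le h₂
        simp at hv
        omega
      · have := h.2.2.2 _ _ _ ⟨true, _, _, _, _, _, _, A.profile_right, h₂, rfl, rfl, rfl⟩
        exact .inl ⟨_, _, _, h₁, by simp at *; omega⟩
    · cases m
      · have := none_le_of_tough hR ht h₁
        have := h.2.1.none_le h₂
        simp at hv hc'
        cases c₁
        · exact .inr ⟨_, _, h₁, by omega⟩
        · have := this.2 (hc' rfl)
          omega
      · have := h.2.1.right_le h₂
        exact .inl ⟨_, _, _, h₁, by simp at *; omega⟩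

/-- The mirror image of `Light.exists_tight_right`. -/
theorem Light.exists_tight_left (h : T.Light) (hR : R.Conn) (ht : T.profile.Tough R)
    (hc : T.Crit R) :
    (∃ c n v, R true false c n v ∧ 2 ≤ v) ∨ ∃ n v, R false false false n v ∧ 1 ≤ v := by
  induction T generalizing R with
  | edge => exact .inr (hc.edge ht)
  | parallel A B hA hB =>
    exact .inl (h.exists_left_of_parallel ht (hA h.1 (conn_parallel_left B.conn_profile)
      (tough_parallel_left ht) hc.parallel_left))
  | series A B hA hB =>
    rcases hB h.2.1 (conn_rev_series hR) (tough_series_right ht) hc.series_right with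
      ⟨_, _, _, ⟨m, c₁, n₁, v₁, c₂, n₂, v₂, h₁, h₂, rfl, rfl, rfl⟩, hv⟩ |
      ⟨_, _, ⟨m, c₁, n₁, v₁, c₂, n₂, v₂, h₁, h₂, hc', rfl, rfl⟩, hv⟩
    · cases m
      · have := none_le_of_tough hR ht h₂
        have := h.1.right_le h₁
        simp at hv
        omega
      · have := h.2.2.1 _ _ _ ⟨true, _, _, _, _, _, _, h₁, B.profile_left, rfl, rfl, rfl⟩
        exact .inl ⟨_, _, _, h₂, by simp at *; omega⟩
    · cases m
      · have := none_le_of_tough hR ht h₂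
        have := h.1.none_le h₁
        simp at hv hc'
        cases c₂
        · exact .inr ⟨_, _, h₂, by omega⟩
        · have := this.2 (by simpa using hc')
          omega
      · have := h.1.left_le h₁
        exact .inl ⟨_, _, _, h₂, by simp at *; omega⟩

/-- For a parallel join the first alternative of `Light.exists_tight_right` holds. -/
theorem Light.parallel_right (h : (A.parallel B).Light) (ht : (A.parallel B).profile.Tough R)
    (hc : (A.parallel B).Crit R) : ∃ c n v, R false true c n v ∧ 2 ≤ v :=
  h.exists_right_of_parallel ht (h.1.exists_tight_right (conn_parallel_left B.conn_profile)
    (tough_parallel_left ht) hc.parallel_left)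

theorem Light.parallel_left (h : (A.parallel B).Light) (ht : (A.parallel B).profile.Tough R)
    (hc : (A.parallel B).Crit R) : ∃ c n v, R true false c n v ∧ 2 ≤ v :=
  h.exists_left_of_parallel ht (h.1.exists_tight_left (conn_parallel_left B.conn_profile)
    (tough_parallel_left ht) hc.parallel_left)

/-! ### Every subgraph with connected complement is light -/

theorem Light.eq_parallel_of_three_le (h : T.Light) {c n v} (hv : T.profile true true c n v)
    (h3 : 3 ≤ v) : ∃ A B, T = .parallel A B := by
  cases T with
  | edge => obtain ⟨_, _, rfl⟩ := hv; simp at h3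
  | series A B => exact absurd (h.series_both_le hv) (by omega)
  | parallel A B => exact ⟨A, B, rfl⟩

/-- The main step. A set of value `2` containing only the left terminal needs a value of at least
`3` between the ends of `A`, so `A` is a parallel join. Tight sets separating the ends of `A` in both
directions then contradict toughness. -/
theorem series_left_le (hA : A.Light) (hB : B.Light) (hR : R.Conn)
    (ht : (A.series B).profile.Tough R) (hc : (A.series B).Crit R) {c n v}
    (hv : (A.series B).profile true false c n v) : v ≤ 1 := by
  by_contra! hv2
  have hv' := hv
  obtain ⟨m, c₁, n₁, v₁, c₂, n₂, v₂, h₁, h₂, rfl, rfl, rfl⟩ := hv'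
  cases m
  · have := hA.left_le h₁
    have := hB.none_le h₂
    simp at hv2
    omega
  have := hB.left_le h₂
  simp only [if_true] at hv2
  obtain ⟨A₁, A₂, rfl⟩ := hA.eq_parallel_of_three_le h₁ (by omega)
  obtain ⟨_, _, _, ⟨m, d₁, k₁, w₁, d₂, k₂, w₂, g₁, g₂, rfl, rfl, rfl⟩, hw⟩ :=
    hA.parallel_left (tough_series_left ht) hc.series_left
  cases m
  · -- a complement of value `2` and the given set together exceed the toughness bound
    have := hB.none_le g₂
    have := ht.le hv g₁
    simp [parLoss] at this hw
    omega
  have := hB.right_le g₂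
  simp only [if_true] at hw
  -- the complement has value `3` between deleted terminals, so toughness leaves no room for `B`
  have hB₀ : ∀ {c n v}, B.profile true true c n v → v ≤ 0 := by
    intro c n v h
    have := ht.le ⟨true, _, _, _, _, _, _, h₁, h, rfl, rfl, rfl⟩ g₁
    simp [parLoss] at this
    omega
  obtain ⟨_, _, _, ⟨m, e₁, l₁, u₁, e₂, l₂, u₂, f₁, f₂, rfl, rfl, rfl⟩, hu⟩ :=
    hA.parallel_right (tough_series_left ht) hc.series_left
  cases m
  · have := none_le_of_tough hR ht f₁
    have := hB.left_le f₂
    simp at hu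
    omega
  · have := hB₀ f₂
    have := ht.le (profile_right _) f₁
    simp [parLoss] at this hu
    omega

/-- The mirror image of `series_left_le`. -/
theorem series_right_le (hA : A.Light) (hB : B.Light) (hR : R.Conn)
    (ht : (A.series B).profile.Tough R) (hc : (A.series B).Crit R) {c n v}
    (hv : (A.series B).profile false true c n v) : v ≤ 1 := by
  by_contra! hv2
  have hv' := hv
  obtain ⟨m, c₁, n₁, v₁, c₂, n₂, v₂, h₁, h₂, rfl, rfl, rfl⟩ := hv'
  cases m
  · have := hB.right_le h₂
    have := hA.none_le h₁
    simp at hv2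
    omega
  have := hA.right_le h₁
  simp only [if_true] at hv2
  obtain ⟨B₁, B₂, rfl⟩ := hB.eq_parallel_of_three_le h₂ (by omega)
  obtain ⟨_, _, _, ⟨m, d₁, k₁, w₁, d₂, k₂, w₂, g₁, g₂, rfl, rfl, rfl⟩, hw⟩ :=
    hB.parallel_right (tough_series_right ht) hc.series_right
  cases m
  · have := hA.none_le g₁
    have := ht.le hv g₂
    simp [parLoss] at this hw
    omega
  have := hA.left_le g₁
  simp only [if_true] at hw
  have hA₀ : ∀ {c n v}, A.profile true true c n v → v ≤ 0 := by
    intro c n v h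
    have := ht.le ⟨true, _, _, _, _, _, _, h, h₂, rfl, rfl, rfl⟩ g₂
    simp [parLoss] at this
    omega
  obtain ⟨_, _, _, ⟨m, e₁, l₁, u₁, e₂, l₂, u₂, f₁, f₂, rfl, rfl, rfl⟩, hu⟩ :=
    hB.parallel_left (tough_series_right ht) hc.series_right
  cases m
  · have := none_le_of_tough hR ht f₂
    have := hA.right_le f₁
    simp at hu
    omega
  · have := hA₀ f₁
    have := ht.le (profile_left _) f₂
    simp [parLoss] at this hu
    omega

theorem light_of_conn (hR : R.Conn) (ht : T.profile.Tough R) (hc : T.Crit R) : T.Light := by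
  induction T generalizing R with
  | edge => trivial
  | parallel A B hA hB =>
    exact ⟨hA (conn_parallel_left B.conn_profile) (tough_parallel_left ht) hc.parallel_left,
      hB (conn_parallel_left A.conn_profile) (tough_parallel_right ht) hc.parallel_right⟩
  | series A B hA hB =>
    have h₁ := hA (conn_series_rev hR) (tough_series_left ht) hc.series_left
    have h₂ := hB (conn_rev_series hR) (tough_series_right ht) hc.series_right
    exact ⟨h₁, h₂, fun _ _ _ ↦ series_left_le h₁ h₂ hR ht hc,
      fun _ _ _ ↦ series_right_le h₁ h₂ hR ht hc⟩

/-! ### The leftmost part of the decomposition -/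

/-- The profile of a graph whose left terminal is isolated and whose remaining vertices form a
connected graph: keeping the left terminal adds one component, and there are two components when
nothing is deleted. -/
def LeftIsolated (R : Profile) : Prop :=
  (∀ b c n v, R true b c n v → R false b false n (v + 1)) ∧
    ∀ c v, R false false c false v → v = 2

theorem leftIsolated_isolated : LeftIsolated isolated := by
  constructor
  · rintro b c n v ⟨rfl, rfl, rfl⟩
    refine ⟨rfl, rfl, ?_⟩
    simp
    ring
  · rintro c v ⟨_, _, rfl⟩
    simp

theorem LeftIsolated.series (h : LeftIsolated R) (B : SPTree) :
    LeftIsolated (R.series B.profile.rev) := by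
  constructor
  · rintro b _ _ _ ⟨m, c₁, n₁, v₁, c₂, n₂, v₂, h₁, h₂, rfl, rfl, rfl⟩
    exact ⟨m, _, _, _, _, _, _, h.1 _ _ _ _ h₁, h₂, by simp, rfl, by ring⟩
  · rintro _ _ ⟨m, c₁, n₁, v₁, c₂, n₂, v₂, h₁, h₂, rfl, hn, rfl⟩
    simp only [Bool.false_eq, Bool.or_eq_false_iff] at hn
    obtain ⟨⟨rfl, rfl⟩, rfl⟩ := hn
    have := h.2 _ _ h₁
    have := (B.profile_of_empty h₂).2
    simp
    omega

/-- If the left terminal has no edge outside `T`, then toughness and criticality force the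
leftmost part of `T` to be a single edge. -/
theorem leftEdge_of_crit (hR : LeftIsolated R) (ht : T.profile.Tough R) (hc : T.Crit R) :
    T.LeftEdge := by
  induction T generalizing R with
  | edge => trivial
  | series A B hA hB => exact hA (hR.series B) (tough_series_left ht) hc.series_left
  | parallel A B hA hB =>
    exfalso
    have h : (A.parallel B).Light :=
      ⟨light_of_conn (conn_parallel_left B.conn_profile) (tough_parallel_left ht)
        hc.parallel_left, light_of_conn (conn_parallel_left A.conn_profile)
        (tough_parallel_right ht) hc.parallel_right⟩
    obtain ⟨c, n, v, h₁, h₂⟩ := h.parallel_left ht hc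
    have h₃ := hR.1 _ _ _ _ h₁
    have := ht.le (profile_empty _) h₃
    cases n
    · have := hR.2 _ _ h₃
      omega
    · simp [parLoss] at this
      omega

end SPTree
end Graph

/-! ### Counting classes of a glued relation -/

section Quot

variable {X Y : Type*}

theorem Nat.card_quot_liftRel [Finite X] [Finite Y] (r : X → X → Prop) (r' : Y → Y → Prop) :
    Nat.card (Quot (Sum.LiftRel r r')) = Nat.card (Quot r) + Nat.card (Quot r') := by
  rw [← Nat.card_sum]
  refine Nat.card_congr
    { toFun := Quot.lift (Sum.map (Quot.mk r) (Quot.mk r')) ?_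
      invFun := Sum.elim (Quot.lift (fun x ↦ Quot.mk _ (.inl x)) ?_)
        (Quot.lift (fun x ↦ Quot.mk _ (.inr x)) ?_)
      left_inv := ?_
      right_inv := ?_ }
  · rintro _ _ (h | h)
    · exact congrArg Sum.inl (Quot.sound h)
    · exact congrArg Sum.inr (Quot.sound h)
  · exact fun _ _ h ↦ Quot.sound (.inl h)
  · exact fun _ _ h ↦ Quot.sound (.inr h)
  · rintro ⟨x | x⟩ <;> rfl
  · rintro (x | x) <;> induction x using Quot.ind <;> rfl

theorem quot_liftRel_inl_ne_inr (r : X → X → Prop) (r' : Y → Y → Prop) (x : X) (y : Y) :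
    Quot.mk (Sum.LiftRel r r') (.inl x) ≠ Quot.mk (Sum.LiftRel r r') (.inr y) := by
  intro h
  have := congrArg (Quot.lift (Sum.elim (fun _ ↦ true) (fun _ ↦ false)) (by
    rintro _ _ (h | h) <;> rfl)) h
  simp at this

theorem Nat.card_quot_or_of_eq (r : X → X → Prop) {x y : X} (h : Quot.mk r x = Quot.mk r y) :
    Nat.card (Quot fun a b ↦ r a b ∨ a = x ∧ b = y) = Nat.card (Quot r) := by
  refine Nat.card_congr
    { toFun := Quot.lift (Quot.mk r) ?_
      invFun := Quot.lift (Quot.mk _) ?_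
      left_inv := ?_
      right_inv := ?_ }
  · rintro a b (h' | ⟨rfl, rfl⟩)
    exacts [Quot.sound h', h]
  · exact fun _ _ h ↦ Quot.sound (.inl h)
  · rintro ⟨x⟩; rfl
  · rintro ⟨x⟩; rfl

/-- Identifying two elements of different classes decreases the number of classes by one. -/
theorem Nat.card_quot_or_of_ne [Finite X] (r : X → X → Prop) {x y : X}
    (h : Quot.mk r x ≠ Quot.mk r y) :
    Nat.card (Quot fun a b ↦ r a b ∨ a = x ∧ b = y) + 1 = Nat.card (Quot r) := by
  classical
  -- the new classes are the old classes other than that of `y`, which is sent to that of `x`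
  let φ : Quot r → {q : Quot r // q ≠ Quot.mk r y} := fun q ↦
    if hq : q = Quot.mk r y then ⟨Quot.mk r x, h⟩ else ⟨q, hq⟩
  have e : (Quot fun a b ↦ r a b ∨ a = x ∧ b = y) ≃ {q : Quot r // q ≠ Quot.mk r y} :=
    { toFun := Quot.lift (fun a ↦ φ (Quot.mk r a)) (by
        rintro a b (h' | ⟨rfl, rfl⟩)
        · exact congrArg φ (Quot.sound h')
        · simp [φ, h])
      invFun := fun q ↦ Quot.lift (Quot.mk _) (fun _ _ h ↦ Quot.sound (.inl h)) q.1
      left_inv := by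
        rintro ⟨a⟩
        by_cases ha : Quot.mk r a = Quot.mk r y
        · have h₁ : φ (Quot.mk r a) = ⟨Quot.mk r x, h⟩ := dif_pos ha
          have h₂ : Quot.mk (fun a b ↦ r a b ∨ a = x ∧ b = y) a = Quot.mk _ y :=
            congrArg (Quot.lift (Quot.mk _) (fun _ _ h ↦ Quot.sound (.inl h))) ha
          change Quot.lift _ _ (φ (Quot.mk r a)).1 = Quot.mk _ a
          rw [h₁, h₂]
          exact Quot.sound (.inr ⟨rfl, rfl⟩)
        · have h₁ : φ (Quot.mk r a) = ⟨Quot.mk r a, ha⟩ := dif_neg ha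
          change Quot.lift _ _ (φ (Quot.mk r a)).1 = Quot.mk _ a
          rw [h₁]
      right_inv := by
        rintro ⟨⟨a⟩, ha⟩
        exact dif_neg ha }
  rw [Nat.card_congr e]
  have := Fintype.ofFinite (Quot r)
  rw [Nat.card_eq_fintype_card, Nat.card_eq_fintype_card, Fintype.card_subtype_compl]
  simp only [Fintype.card_unique]
  exact Nat.sub_add_cancel (Fintype.card_pos_iff.2 ⟨Quot.mk r x⟩)

end Quot

namespace Graph

open Set
open scoped Graph

variable {α β : Type*}

/-! ### Components of glued graphs -/

/-- `x` and `y` are joined by a walk. -/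
def Joined (H : Graph α β) : α → α → Prop := Relation.ReflTransGen H.Adj

theorem quot_mk_eq_iff (H : Graph α β) (x y : V(H)) :
    Quot.mk (fun x y : V(H) ↦ H.Adj x y) x = Quot.mk _ y ↔ H.Joined x y := by
  constructor
  · intro h
    have h' := Quot.eqvGen_exact h
    clear h
    induction h' with
    | rel _ _ h => exact .single h
    | refl => exact .refl
    | symm _ _ _ h =>
      have : Std.Symm H.Adj := ⟨fun _ _ h ↦ h.symm⟩
      exact Relation.ReflTransGen.stdSymm.symm _ _ h
    | trans _ _ _ _ _ h₁ h₂ => exact h₁.trans h₂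
  · obtain ⟨x, hx⟩ := x
    obtain ⟨y, hy⟩ := y
    intro h
    change Relation.ReflTransGen H.Adj x y at h
    induction h with
    | refl => rfl
    | tail _ h ih => exact (ih h.left_mem).trans (Quot.sound h)

theorem numComponents_eq_card_quot (H : Graph α β) :
    H.numComponents = Nat.card (Quot fun x y : V(H) ↦ H.Adj x y) := by
  refine Nat.card_congr
    { toFun := Quot.lift (Quot.mk _) ?_
      invFun := Quot.lift (Quot.mk _) ?_
      left_inv := ?_
      right_inv := ?_ }
  · rintro x y ⟨p⟩
    induction p with
    | nil => rfl
    | cons h _ ih => exact (Quot.sound (r := fun x y : V(H) ↦ H.Adj x y) h.2).trans ih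
  · intro x y h
    by_cases hxy : x = y
    · rw [hxy]
    · exact Quot.sound (SimpleGraph.Adj.reachable (G := H.toSimpleGraph) ⟨hxy, h⟩)
  · rintro ⟨x⟩; rfl
  · rintro ⟨x⟩; rfl

theorem numComponents_congr {H H' : Graph α β} (hV : V(H) = V(H'))
    (hA : ∀ x y, H.Adj x y ↔ H'.Adj x y) : H.numComponents = H'.numComponents := by
  rw [numComponents_eq_card_quot, numComponents_eq_card_quot]
  have : (fun x y : V(H) ↦ H.Adj x y) = fun x y : V(H) ↦ H'.Adj x y := by
    funext x y
    exact propext (hA _ _)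
  rw [this]
  generalize V(H) = V at *
  subst hV
  rfl

theorem numComponents_le_ncard (H : Graph α β) (hf : V(H).Finite) :
    H.numComponents ≤ V(H).ncard := by
  have := hf.to_subtype
  rw [numComponents_eq_card_quot]
  exact Nat.card_le_card_of_surjective (Quot.mk _) Quot.mk_surjective

theorem numComponents_eq_ncard (H : Graph α β) (h : ∀ x y, ¬ H.Adj x y) :
    H.numComponents = V(H).ncard := by
  rw [numComponents_eq_card_quot]
  refine (Nat.card_congr (Equiv.ofBijective (Quot.mk _)
    ⟨fun x y hxy ↦ ?_, Quot.mk_surjective⟩)).symm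
  rw [quot_mk_eq_iff] at hxy
  rcases hxy.cases_head with hxy | ⟨_, h', _⟩
  · exact Subtype.ext hxy
  · exact absurd h' (h _ _)

theorem numComponents_eq_one (H : Graph α β) (hne : V(H).Nonempty)
    (h : ∀ x ∈ V(H), ∀ y ∈ V(H), H.Joined x y) : H.numComponents = 1 := by
  rw [numComponents_eq_card_quot, Nat.card_eq_one_iff_unique]
  refine ⟨⟨?_⟩, ⟨Quot.mk _ ⟨_, hne.some_mem⟩⟩⟩
  rintro ⟨x⟩ ⟨y⟩
  exact (quot_mk_eq_iff H x y).2 (h _ x.2 _ y.2)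

/-- Two vertices that are not joined lie in different components. -/
theorem one_lt_numComponents (H : Graph α β) (hf : V(H).Finite) {x y : α} (hx : x ∈ V(H))
    (hy : y ∈ V(H)) (h : ¬ H.Joined x y) : 1 < H.numComponents := by
  have := hf.to_subtype
  rw [numComponents_eq_card_quot, Finite.one_lt_card_iff_nontrivial]
  exact ⟨Quot.mk _ ⟨x, hx⟩, Quot.mk _ ⟨y, hy⟩, fun h' ↦ h ((quot_mk_eq_iff H ⟨x, hx⟩ ⟨y, hy⟩).1 h')⟩

/-- The vertices and adjacencies of `H` are those of `H₁` together with those of `H₂`. -/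
structure IsJoin (H H₁ H₂ : Graph α β) : Prop where
  vertexSet_eq : V(H) = V(H₁) ∪ V(H₂)
  adj_iff : ∀ x y, H.Adj x y ↔ H₁.Adj x y ∨ H₂.Adj x y

namespace IsJoin

variable {H H₁ H₂ : Graph α β}

/-- The classes of a union are obtained from the disjoint sum by identifying the two copies of each
common vertex. -/
theorem numComponents_eq (h : H.IsJoin H₁ H₂) :
    H.numComponents = Nat.card (Quot fun a b : V(H₁) ⊕ V(H₂) ↦
      Sum.LiftRel (fun x y : V(H₁) ↦ H₁.Adj x y) (fun x y : V(H₂) ↦ H₂.Adj x y) a b ∨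
      ∃ (w : α) (h₁ : w ∈ V(H₁)) (h₂ : w ∈ V(H₂)), a = .inl ⟨w, h₁⟩ ∧ b = .inr ⟨w, h₂⟩) := by
  classical
  have hV := h.vertexSet_eq
  rw [numComponents_eq_card_quot]
  refine (Nat.card_congr
    { toFun := Quot.lift (Sum.elim (fun x ↦ Quot.mk _ ⟨x.1, hV ▸ .inl x.2⟩)
        (fun x ↦ Quot.mk _ ⟨x.1, hV ▸ .inr x.2⟩)) ?_
      invFun := Quot.lift (fun x ↦ if hx : x.1 ∈ V(H₁) then Quot.mk _ (.inl ⟨x.1, hx⟩)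
        else Quot.mk _ (.inr ⟨x.1, (hV ▸ x.2 : x.1 ∈ V(H₁) ∪ V(H₂)).resolve_left hx⟩)) ?_
      left_inv := ?_
      right_inv := ?_ }).symm
  · rintro _ _ ((h' | h') | ⟨w, h₁, h₂, rfl, rfl⟩)
    · exact Quot.sound ((h.adj_iff _ _).2 (.inl h'))
    · exact Quot.sound ((h.adj_iff _ _).2 (.inr h'))
    · rfl
  · have key : ∀ (z : α) (hz : z ∈ V(H)) (h₂ : z ∈ V(H₂)),
        (if hx : z ∈ V(H₁) then Quot.mk (fun a b : V(H₁) ⊕ V(H₂) ↦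
          Sum.LiftRel (fun x y : V(H₁) ↦ H₁.Adj x y) (fun x y : V(H₂) ↦ H₂.Adj x y) a b ∨
          ∃ (w : α) (h₁ : w ∈ V(H₁)) (h₂ : w ∈ V(H₂)), a = .inl ⟨w, h₁⟩ ∧ b = .inr ⟨w, h₂⟩)
            (.inl ⟨z, hx⟩)
        else Quot.mk _ (.inr ⟨z, (hV ▸ hz : z ∈ V(H₁) ∪ V(H₂)).resolve_left hx⟩)) =
          Quot.mk _ (.inr ⟨z, h₂⟩) := by
      intro z hz h₂
      split_ifs with hx
      · exact Quot.sound (.inr ⟨z, hx, h₂, rfl, rfl⟩)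
      · rfl
    intro x y hxy
    rcases (h.adj_iff _ _).1 hxy with h' | h'
    · rw [dif_pos h'.left_mem, dif_pos h'.right_mem]
      exact Quot.sound (.inl (.inl h'))
    · rw [key _ x.2 h'.left_mem, key _ y.2 h'.right_mem]
      exact Quot.sound (.inl (.inr h'))
  · rintro ⟨x | x⟩
    · exact dif_pos x.2
    · change (if hx : x.1 ∈ V(H₁) then _ else _) = _
      split_ifs with hx
      · exact Quot.sound (.inr ⟨x.1, hx, x.2, rfl, rfl⟩)
      · rfl
  · rintro ⟨x⟩
    change Quot.lift _ _ (if hx : x.1 ∈ V(H₁) then _ else _) = _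
    split_ifs with hx <;> rfl

theorem numComponents_of_disjoint (h : H.IsJoin H₁ H₂) (hf₁ : V(H₁).Finite) (hf₂ : V(H₂).Finite)
    (hd : ∀ w, w ∈ V(H₁) → w ∉ V(H₂)) :
    H.numComponents = H₁.numComponents + H₂.numComponents := by
  have := hf₁.to_subtype
  have := hf₂.to_subtype
  rw [h.numComponents_eq, numComponents_eq_card_quot H₁, numComponents_eq_card_quot H₂,
    ← Nat.card_quot_liftRel]
  congr 2
  funext a b
  refine propext ⟨?_, .inl⟩
  rintro (h' | ⟨w, h₁, h₂, _⟩)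
  exacts [h', absurd h₂ (hd w h₁)]

theorem numComponents_of_inter_eq_singleton (h : H.IsJoin H₁ H₂) (hf₁ : V(H₁).Finite)
    (hf₂ : V(H₂).Finite) {m : α} (hm : V(H₁) ∩ V(H₂) = {m}) :
    H.numComponents + 1 = H₁.numComponents + H₂.numComponents := by
  have := hf₁.to_subtype
  have := hf₂.to_subtype
  have hm' : m ∈ V(H₁) ∩ V(H₂) := hm ▸ rfl
  rw [h.numComponents_eq, numComponents_eq_card_quot H₁, numComponents_eq_card_quot H₂,
    ← Nat.card_quot_liftRel, ← Nat.card_quot_or_of_ne _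
      (quot_liftRel_inl_ne_inr (fun x y : V(H₁) ↦ H₁.Adj x y) (fun x y : V(H₂) ↦ H₂.Adj x y)
        ⟨m, hm'.1⟩ ⟨m, hm'.2⟩)]
  congr 3
  funext a b
  refine propext (or_congr_right ⟨?_, fun h ↦ ⟨m, hm'.1, hm'.2, h⟩⟩)
  rintro ⟨w, h₁, h₂, h'⟩
  obtain rfl : w = m := (hm ▸ ⟨h₁, h₂⟩ : w ∈ ({m} : Set α))
  exact h'

theorem numComponents_of_inter_eq_pair (h : H.IsJoin H₁ H₂) (hf₁ : V(H₁).Finite)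
    (hf₂ : V(H₂).Finite) {s t : α} (hst : s ≠ t) (hW : V(H₁) ∩ V(H₂) = {s, t}) :
    (H₁.Joined s t ∧ H₂.Joined s t →
      H.numComponents + 1 = H₁.numComponents + H₂.numComponents) ∧
    (¬ (H₁.Joined s t ∧ H₂.Joined s t) →
      H.numComponents + 2 = H₁.numComponents + H₂.numComponents) := by
  classical
  have := hf₁.to_subtype
  have := hf₂.to_subtype
  have hs : s ∈ V(H₁) ∩ V(H₂) := hW ▸ .inl rfl
  have ht : t ∈ V(H₁) ∩ V(H₂) := hW ▸ .inr rfl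
  set ρ := Sum.LiftRel (fun x y : V(H₁) ↦ H₁.Adj x y) (fun x y : V(H₂) ↦ H₂.Adj x y) with hρ
  set ρ' : V(H₁) ⊕ V(H₂) → V(H₁) ⊕ V(H₂) → Prop :=
    fun a b ↦ ρ a b ∨ a = .inl ⟨s, hs.1⟩ ∧ b = .inr ⟨s, hs.2⟩ with hρ'
  have h₁ : Nat.card (Quot ρ') + 1 = H₁.numComponents + H₂.numComponents := by
    rw [numComponents_eq_card_quot H₁, numComponents_eq_card_quot H₂, ← Nat.card_quot_liftRel]
    exact Nat.card_quot_or_of_ne _ (quot_liftRel_inl_ne_inr _ _ _ _)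
  have h₂ : H.numComponents = Nat.card (Quot fun a b ↦ ρ' a b ∨
      a = .inl ⟨t, ht.1⟩ ∧ b = .inr ⟨t, ht.2⟩) := by
    rw [h.numComponents_eq]
    congr 2
    funext a b
    rw [hρ', or_assoc]
    refine propext (or_congr_right ⟨?_, ?_⟩)
    · rintro ⟨w, h₁, h₂, h'⟩
      have hw : w ∈ ({s, t} : Set α) := hW ▸ ⟨h₁, h₂⟩
      rcases hw with rfl | rfl
      exacts [.inl h', .inr h']
    · rintro (h' | h')
      exacts [⟨s, hs.1, hs.2, h'⟩, ⟨t, ht.1, ht.2, h'⟩]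
  -- after gluing at `s`, the two copies of `t` are joined iff `s` and `t` are joined on both sides
  have h₃ : Quot.mk ρ' (.inl ⟨t, ht.1⟩) = Quot.mk ρ' (.inr ⟨t, ht.2⟩) ↔
      H₁.Joined s t ∧ H₂.Joined s t := by
    rw [← quot_mk_eq_iff H₁ ⟨s, hs.1⟩ ⟨t, ht.1⟩, ← quot_mk_eq_iff H₂ ⟨s, hs.2⟩ ⟨t, ht.2⟩]
    constructor
    · intro h'
      -- map to the classes of one side, sending the whole other side to the class of `s`
      have k₁ := congrArg (Quot.lift (Sum.elim
        (fun x ↦ Quot.mk (fun x y : V(H₁) ↦ H₁.Adj x y) x) (fun _ ↦ Quot.mk _ ⟨s, hs.1⟩)) (by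
          rintro _ _ ((h | h) | ⟨rfl, rfl⟩)
          exacts [Quot.sound h, rfl, rfl])) h'
      have k₂ := congrArg (Quot.lift (Sum.elim (fun _ ↦ Quot.mk _ ⟨s, hs.2⟩)
        (fun x ↦ Quot.mk (fun x y : V(H₂) ↦ H₂.Adj x y) x)) (by
          rintro _ _ ((h | h) | ⟨rfl, rfl⟩)
          exacts [rfl, Quot.sound h, rfl])) h'
      exact ⟨k₁.symm, k₂⟩
    · rintro ⟨k₁, k₂⟩
      have l₁ := congrArg (Quot.lift (fun x ↦ Quot.mk ρ' (.inl x))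
        (fun _ _ h ↦ Quot.sound (.inl (.inl h)))) k₁
      have l₂ := congrArg (Quot.lift (fun x ↦ Quot.mk ρ' (.inr x))
        (fun _ _ h ↦ Quot.sound (.inl (.inr h)))) k₂
      exact l₁.symm.trans ((Quot.sound (.inr ⟨rfl, rfl⟩)).trans l₂)
  refine ⟨fun h' ↦ ?_, fun h' ↦ ?_⟩
  · rw [h₂, Nat.card_quot_or_of_eq _ (h₃.2 h'), h₁]
  · rw [h₂, ← h₁, ← Nat.card_quot_or_of_ne ρ' (fun h ↦ h' (h₃.1 h))]

theorem joined_left (h : H.IsJoin H₁ H₂) {x y : α} (h' : H₁.Joined x y) : H.Joined x y :=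
  Relation.ReflTransGen.mono (fun _ _ h' ↦ (h.adj_iff _ _).2 (.inl h')) _ _ h'

theorem joined_right (h : H.IsJoin H₁ H₂) {x y : α} (h' : H₂.Joined x y) : H.Joined x y :=
  Relation.ReflTransGen.mono (fun _ _ h' ↦ (h.adj_iff _ _).2 (.inr h')) _ _ h'

theorem joined_of_inter_eq_singleton (h : H.IsJoin H₁ H₂) {s m t : α}
    (hm : V(H₁) ∩ V(H₂) = {m}) (hs : s ∈ V(H₁)) (ht : t ∈ V(H₂)) :
    H.Joined s t ↔ H₁.Joined s m ∧ H₂.Joined m t := by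
  have hm' : ∀ {x}, x ∈ V(H₁) → x ∈ V(H₂) → x = m := fun h₁ h₂ ↦ by
    have : _ ∈ V(H₁) ∩ V(H₂) := ⟨h₁, h₂⟩
    rwa [hm] at this
  constructor
  · intro h'
    have key : (t ∈ V(H₁) ∧ H₁.Joined s t) ∨ (t ∈ V(H₂) ∧ H₁.Joined s m ∧ H₂.Joined m t) := by
      clear ht
      induction h' with
      | refl => exact .inl ⟨hs, .refl⟩
      | tail _ h' ih =>
        rcases (h.adj_iff _ _).1 h' with h' | h'
        · rcases ih with ⟨h₁, h₂⟩ | ⟨h₁, h₂, h₃⟩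
          · exact .inl ⟨h'.right_mem, h₂.tail h'⟩
          · obtain rfl := hm' h'.left_mem h₁
            exact .inl ⟨h'.right_mem, h₂.tail h'⟩
        · rcases ih with ⟨h₁, h₂⟩ | ⟨h₁, h₂, h₃⟩
          · obtain rfl := hm' h₁ h'.left_mem
            exact .inr ⟨h'.right_mem, h₂, .single h'⟩
          · exact .inr ⟨h'.right_mem, h₂, h₃.tail h'⟩
    rcases key with ⟨h₁, h₂⟩ | ⟨_, h⟩
    · obtain rfl := hm' h₁ ht
      exact ⟨h₂, .refl⟩
    · exact h
  · rintro ⟨h₁, h₂⟩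
    exact (h.joined_left h₁).trans (h.joined_right h₂)

theorem not_joined_of_disjoint (h : H.IsJoin H₁ H₂) {s t : α}
    (hd : ∀ w, w ∈ V(H₁) → w ∉ V(H₂)) (hs : s ∈ V(H₁)) (ht : t ∈ V(H₂)) : ¬ H.Joined s t := by
  intro h'
  suffices t ∈ V(H₁) from hd _ this ht
  clear ht
  induction h' with
  | refl => exact hs
  | tail _ h' ih =>
    rcases (h.adj_iff _ _).1 h' with h' | h'
    · exact h'.right_mem
    · exact absurd h'.left_mem (hd _ ih)

theorem joined_of_inter_eq_pair (h : H.IsJoin H₁ H₂) {s t : α}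
    (hW : V(H₁) ∩ V(H₂) = {s, t}) : H.Joined s t ↔ H₁.Joined s t ∨ H₂.Joined s t := by
  have hW' : ∀ {x}, x ∈ V(H₁) → x ∈ V(H₂) → x = s ∨ x = t := fun h₁ h₂ ↦ by
    have : _ ∈ V(H₁) ∩ V(H₂) := ⟨h₁, h₂⟩
    rwa [hW] at this
  have hs : s ∈ V(H₁) ∩ V(H₂) := hW ▸ .inl rfl
  constructor
  · intro h'
    by_contra! hn
    have key : ∀ {x}, H.Joined s x →
        (x ∈ V(H₁) ∧ H₁.Joined s x) ∨ (x ∈ V(H₂) ∧ H₂.Joined s x) := by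
      intro x hx
      induction hx with
      | refl => exact .inl ⟨hs.1, .refl⟩
      | tail _ hadj ih =>
        rcases (h.adj_iff _ _).1 hadj with hxy | hxy
        · refine .inl ⟨hxy.right_mem, ?_⟩
          rcases ih with ⟨h₁, h₂⟩ | ⟨h₁, h₂⟩
          · exact h₂.tail hxy
          · rcases hW' hxy.left_mem h₁ with rfl | rfl
            exacts [.single hxy, absurd h₂ hn.2]
        · refine .inr ⟨hxy.right_mem, ?_⟩
          rcases ih with ⟨h₁, h₂⟩ | ⟨h₁, h₂⟩
          · rcases hW' h₁ hxy.left_mem with rfl | rfl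
            exacts [.single hxy, absurd h₂ hn.1]
          · exact h₂.tail hxy
    rcases key h' with ⟨_, h₁⟩ | ⟨_, h₁⟩
    exacts [hn.1 h₁, hn.2 h₁]
  · rintro (h' | h')
    exacts [h.joined_left h', h.joined_right h']

/-- Deleting vertices is compatible with unions. -/
theorem deleteVerts (h : H.IsJoin H₁ H₂) (S : Set α) :
    (H.deleteVerts S).IsJoin (H₁.deleteVerts (S ∩ V(H₁))) (H₂.deleteVerts (S ∩ V(H₂))) := by
  constructor
  · simp only [vertexSet_deleteVerts, h.vertexSet_eq, Set.sdiff_inter_self_eq_sdiff,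
      Set.union_sdiff_distrib]
  · intro x y
    have h₀ : ∀ (K : Graph α β) (X : Set α), (K.deleteVerts X).Adj x y ↔
        K.Adj x y ∧ x ∉ X ∧ y ∉ X := by
      intro K X
      simp [Adj]
    have h₁ : ∀ K : Graph α β, (K.deleteVerts (S ∩ V(K))).Adj x y ↔ K.Adj x y ∧ x ∉ S ∧ y ∉ S := by
      intro K
      rw [h₀]
      refine and_congr_right fun h' ↦ ?_
      simp [h'.left_mem, h'.right_mem]
    rw [h₀, h₁, h₁, h.adj_iff, or_and_right]

end IsJoin

open Profile

/-! ### The profile of a graph with two terminals -/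

/-- The profile of the graph `G` with terminals `s` and `t`. -/
def profile (G : Graph α β) (s t : α) : Profile := fun a b c n v ↦
  ∃ S ⊆ V(G), (a = true ↔ s ∈ S) ∧ (b = true ↔ t ∈ S) ∧
    (c = true ↔ s ∉ S ∧ t ∉ S ∧ (G.deleteVerts S).Joined s t) ∧
    (n = true ↔ (S \ {s, t}).Nonempty) ∧
    v = (G.deleteVerts S).numComponents - 2 * ((S \ {s, t}).ncard : ℤ)

theorem exists_bool_iff (p : Prop) : ∃ b : Bool, b = true ↔ p := by
  classical
  exact ⟨decide p, decide_eq_true_iff⟩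

/-- Every vertex set gives an entry of the profile. -/
theorem exists_profile (G : Graph α β) (s t : α) {S : Set α} (hS : S ⊆ V(G)) :
    ∃ a b c n v, G.profile s t a b c n v ∧ (a = true ↔ s ∈ S) ∧ (b = true ↔ t ∈ S) ∧
      (c = true ↔ s ∉ S ∧ t ∉ S ∧ (G.deleteVerts S).Joined s t) ∧
      (n = true ↔ (S \ {s, t}).Nonempty) ∧
      v = (G.deleteVerts S).numComponents - 2 * ((S \ {s, t}).ncard : ℤ) := by
  obtain ⟨a, ha⟩ := exists_bool_iff (s ∈ S)
  obtain ⟨b, hb⟩ := exists_bool_iff (t ∈ S)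
  obtain ⟨c, hc⟩ := exists_bool_iff (s ∉ S ∧ t ∉ S ∧ (G.deleteVerts S).Joined s t)
  obtain ⟨n, hn⟩ := exists_bool_iff (S \ {s, t}).Nonempty
  exact ⟨a, b, c, n, _, ⟨S, hS, ha, hb, hc, hn, rfl⟩, ha, hb, hc, hn, rfl⟩

variable {G G₁ G₂ : Graph α β} {s m t : α}

namespace IsJoin

theorem numComponents_series (h : G.IsJoin G₁ G₂) (hm : V(G₁) ∩ V(G₂) = {m})
    (hf₁ : V(G₁).Finite) (hf₂ : V(G₂).Finite) (S : Set α) :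
    (m ∈ S → (G.deleteVerts S).numComponents = (G₁.deleteVerts (S ∩ V(G₁))).numComponents +
      (G₂.deleteVerts (S ∩ V(G₂))).numComponents) ∧
    (m ∉ S → (G.deleteVerts S).numComponents + 1 = (G₁.deleteVerts (S ∩ V(G₁))).numComponents +
      (G₂.deleteVerts (S ∩ V(G₂))).numComponents) := by
  have h' := h.deleteVerts S
  refine ⟨fun hmS ↦ h'.numComponents_of_disjoint hf₁.sdiff hf₂.sdiff ?_, fun hmS ↦
    h'.numComponents_of_inter_eq_singleton hf₁.sdiff hf₂.sdiff (m := m) ?_⟩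
  · rintro w ⟨h₁, h₂⟩ ⟨h₃, h₄⟩
    obtain rfl : w = m := (hm ▸ ⟨h₁, h₃⟩ : w ∈ ({m} : Set α))
    exact h₂ ⟨hmS, h₁⟩
  · have hm' : m ∈ V(G₁) ∩ V(G₂) := hm ▸ rfl
    ext w
    simp only [vertexSet_deleteVerts]
    constructor
    · rintro ⟨⟨h₁, h₂⟩, h₃, h₄⟩
      exact hm ▸ ⟨h₁, h₃⟩
    · rintro rfl
      exact ⟨⟨hm'.1, fun h ↦ hmS h.1⟩, hm'.2, fun h ↦ hmS h.1⟩

theorem joined_series (h : G.IsJoin G₁ G₂) (hm : V(G₁) ∩ V(G₂) = {m}) (hs : s ∈ V(G₁))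
    (ht : t ∈ V(G₂)) (S : Set α) :
    (s ∉ S ∧ t ∉ S ∧ (G.deleteVerts S).Joined s t) ↔ m ∉ S ∧
      (s ∉ S ∩ V(G₁) ∧ m ∉ S ∩ V(G₁) ∧ (G₁.deleteVerts (S ∩ V(G₁))).Joined s m) ∧
      (m ∉ S ∩ V(G₂) ∧ t ∉ S ∩ V(G₂) ∧ (G₂.deleteVerts (S ∩ V(G₂))).Joined m t) := by
  have h' := h.deleteVerts S
  have hm' : m ∈ V(G₁) ∩ V(G₂) := hm ▸ rfl
  simp only [mem_inter_iff, hs, ht, hm'.1, hm'.2, and_true]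
  by_cases hsS : s ∈ S
  · simp [hsS]
  by_cases htS : t ∈ S
  · simp [htS]
  by_cases hmS : m ∈ S
  · simp only [hsS, htS, hmS, not_true_eq_false, not_false_eq_true, true_and, false_and, iff_false]
    refine h'.not_joined_of_disjoint ?_ ⟨hs, fun h ↦ hsS h.1⟩ ⟨ht, fun h ↦ htS h.1⟩
    rintro w ⟨h₁, h₂⟩ ⟨h₃, h₄⟩
    obtain rfl : w = m := (hm ▸ ⟨h₁, h₃⟩ : w ∈ ({m} : Set α))
    exact h₂ ⟨hmS, h₁⟩
  · simp only [hsS, htS, hmS, not_false_eq_true, true_and]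
    refine h'.joined_of_inter_eq_singleton ?_ ⟨hs, fun h ↦ hsS h.1⟩ ⟨ht, fun h ↦ htS h.1⟩
    ext w
    simp only [vertexSet_deleteVerts]
    constructor
    · rintro ⟨⟨h₁, h₂⟩, h₃, h₄⟩
      exact hm ▸ ⟨h₁, h₃⟩
    · rintro rfl
      exact ⟨⟨hm'.1, fun h ↦ hmS h.1⟩, hm'.2, fun h ↦ hmS h.1⟩

theorem sdiff_series (h : G.IsJoin G₁ G₂) (hm : V(G₁) ∩ V(G₂) = {m}) (hs : s ∈ V(G₁))
    (ht : t ∈ V(G₂)) (hsm : s ≠ m) (hmt : m ≠ t) {S : Set α} (hS : S ⊆ V(G)) :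
    S \ {s, t} = (S ∩ {m}) ∪ ((S ∩ V(G₁)) \ {s, m} ∪ (S ∩ V(G₂)) \ {m, t}) := by
  have hm' : ∀ {x}, x ∈ V(G₁) → x ∈ V(G₂) → x = m := fun h₁ h₂ ↦ by
    have : _ ∈ V(G₁) ∩ V(G₂) := ⟨h₁, h₂⟩
    rwa [hm] at this
  rw [h.vertexSet_eq] at hS
  ext x
  simp only [mem_sdiff, mem_insert_iff, mem_singleton_iff, mem_union, mem_inter_iff, not_or]
  constructor
  · rintro ⟨hx, hxs, hxt⟩
    by_cases hxm : x = m
    · exact .inl ⟨hx, hxm⟩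
    · rcases hS hx with h₁ | h₁
      · exact .inr (.inl ⟨⟨hx, h₁⟩, hxs, hxm⟩)
      · exact .inr (.inr ⟨⟨hx, h₁⟩, hxm, hxt⟩)
  · rintro (⟨hx, rfl⟩ | ⟨⟨hx, h₁⟩, hxs, hxm⟩ | ⟨⟨hx, h₁⟩, hxm, hxt⟩)
    · exact ⟨hx, hsm.symm, hmt⟩
    · refine ⟨hx, hxs, ?_⟩
      rintro rfl
      exact hxm (hm' h₁ ht)
    · refine ⟨hx, ?_, hxt⟩
      rintro rfl
      exact hxm (hm' hs h₁)

theorem ncard_sdiff_series (h : G.IsJoin G₁ G₂) (hm : V(G₁) ∩ V(G₂) = {m}) (hs : s ∈ V(G₁))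
    (ht : t ∈ V(G₂)) (hsm : s ≠ m) (hmt : m ≠ t) (hf₁ : V(G₁).Finite) (hf₂ : V(G₂).Finite)
    {S : Set α} (hS : S ⊆ V(G)) :
    (S \ {s, t}).ncard = (S ∩ {m}).ncard + (((S ∩ V(G₁)) \ {s, m}).ncard +
      ((S ∩ V(G₂)) \ {m, t}).ncard) := by
  have hf₁' : ((S ∩ V(G₁)) \ {s, m}).Finite := (hf₁.inter_of_right S).sdiff
  have hf₂' : ((S ∩ V(G₂)) \ {m, t}).Finite := (hf₂.inter_of_right S).sdiff
  rw [h.sdiff_series hm hs ht hsm hmt hS, ncard_union_eq ?_ ((finite_singleton m).inter_of_right S)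
    (hf₁'.union hf₂'), ncard_union_eq ?_ hf₁' hf₂']
  · rw [Set.disjoint_left]
    rintro x ⟨⟨_, h₁⟩, h₂⟩ ⟨⟨_, h₃⟩, _⟩
    have : x ∈ ({m} : Set α) := hm ▸ ⟨h₁, h₃⟩
    exact h₂ (.inr this)
  · rw [Set.disjoint_left]
    rintro x ⟨_, rfl⟩ (⟨_, h₁⟩ | ⟨_, h₁⟩)
    · exact h₁ (.inr rfl)
    · exact h₁ (.inl rfl)

theorem profile_series (h : G.IsJoin G₁ G₂) (hm : V(G₁) ∩ V(G₂) = {m}) (hs : s ∈ V(G₁))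
    (ht : t ∈ V(G₂)) (hsm : s ≠ m) (hmt : m ≠ t) (hf₁ : V(G₁).Finite) (hf₂ : V(G₂).Finite) :
    G.profile s t = (G₁.profile s m).series (G₂.profile m t) := by
  have hm' : m ∈ V(G₁) ∩ V(G₂) := hm ▸ rfl
  have key : ∀ {S}, S ⊆ V(G) → ∀ {k : Bool}, (k = true ↔ m ∈ S) →
      ((G.deleteVerts S).numComponents : ℤ) - 2 * ((S \ {s, t}).ncard : ℤ) =
      ((G₁.deleteVerts (S ∩ V(G₁))).numComponents - 2 * (((S ∩ V(G₁)) \ {s, m}).ncard : ℤ)) +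
      ((G₂.deleteVerts (S ∩ V(G₂))).numComponents - 2 * (((S ∩ V(G₂)) \ {m, t}).ncard : ℤ)) -
      if k then 2 else 1 := by
    intro S hS k hk
    obtain ⟨h₁, h₂⟩ := h.numComponents_series hm hf₁ hf₂ S
    have h₃ := h.ncard_sdiff_series hm hs ht hsm hmt hf₁ hf₂ hS
    cases k
    · have hmS : m ∉ S := by simpa using hk
      have h₄ : S ∩ {m} = ∅ := by simpa using hmS
      have := h₂ hmS
      rw [h₄, ncard_empty] at h₃
      simp only [Bool.false_eq_true, if_false]
      omega
    · have hmS : m ∈ S := by simpa using hk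
      have h₄ : S ∩ {m} = {m} := by simpa using hmS
      have := h₁ hmS
      rw [h₄, ncard_singleton] at h₃
      simp only [if_true]
      omega
  have keyn : ∀ {S}, S ⊆ V(G) → ((S \ {s, t}).Nonempty ↔ (m ∈ S ∨
      ((S ∩ V(G₁)) \ {s, m}).Nonempty) ∨ ((S ∩ V(G₂)) \ {m, t}).Nonempty) := by
    intro S hS
    rw [h.sdiff_series hm hs ht hsm hmt hS, union_nonempty, union_nonempty, or_assoc]
    simp
  funext a b c n v
  refine propext ⟨?_, ?_⟩
  · rintro ⟨S, hS, ha, hb, hc, hn, rfl⟩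
    obtain ⟨a', k, c₁, n₁, v₁, hp₁, ha', hk, hc₁, hn₁, rfl⟩ :=
      exists_profile G₁ s m (S := S ∩ V(G₁)) inter_subset_right
    obtain ⟨k', b', c₂, n₂, v₂, hp₂, hk', hb', hc₂, hn₂, rfl⟩ :=
      exists_profile G₂ m t (S := S ∩ V(G₂)) inter_subset_right
    simp only [mem_inter_iff, hs, hm'.1, hm'.2, ht, and_true] at ha' hk hk' hb'
    obtain rfl : a = a' := Bool.eq_iff_iff.2 (ha.trans ha'.symm)
    obtain rfl : b = b' := Bool.eq_iff_iff.2 (hb.trans hb'.symm)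
    obtain rfl : k = k' := Bool.eq_iff_iff.2 (hk.trans hk'.symm)
    refine ⟨k, c₁, n₁, _, c₂, n₂, _, hp₁, hp₂, Bool.eq_iff_iff.2 ?_, Bool.eq_iff_iff.2 ?_,
      key hS hk⟩
    · rw [hc, h.joined_series hm hs ht, ← hc₁, ← hc₂, ← hk]
      simp [and_assoc]
    · rw [hn, keyn hS, ← hk, ← hn₁, ← hn₂, Bool.or_eq_true, Bool.or_eq_true]
  · rintro ⟨k, c₁, n₁, _, c₂, n₂, _, ⟨S₁, hS₁, ha, hk, hc₁, hn₁, rfl⟩,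
      ⟨S₂, hS₂, hk', hb, hc₂, hn₂, rfl⟩, rfl, rfl, rfl⟩
    have hS : S₁ ∪ S₂ ⊆ V(G) := h.vertexSet_eq ▸ union_subset_union hS₁ hS₂
    have hm'' : ∀ {x}, x ∈ V(G₁) → x ∈ V(G₂) → x = m := fun h₁ h₂ ↦ by
      have : _ ∈ V(G₁) ∩ V(G₂) := ⟨h₁, h₂⟩
      rwa [hm] at this
    have e₁ : (S₁ ∪ S₂) ∩ V(G₁) = S₁ := by
      ext x
      constructor
      · rintro ⟨hx | hx, hx'⟩
        · exact hx
        · obtain rfl := hm'' hx' (hS₂ hx)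
          exact hk.1 (hk'.2 hx)
      · exact fun hx ↦ ⟨.inl hx, hS₁ hx⟩
    have e₂ : (S₁ ∪ S₂) ∩ V(G₂) = S₂ := by
      ext x
      constructor
      · rintro ⟨hx | hx, hx'⟩
        · obtain rfl := hm'' (hS₁ hx) hx'
          exact hk'.1 (hk.2 hx)
        · exact hx
      · exact fun hx ↦ ⟨.inr hx, hS₂ hx⟩
    have hkS : k = true ↔ m ∈ S₁ ∪ S₂ := by
      rw [mem_union, ← hk, ← hk', or_self]
    refine ⟨S₁ ∪ S₂, hS, ?_, ?_, ?_, ?_, ?_⟩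
    · rw [ha]
      nth_rw 1 [← e₁]
      simp [hs]
    · rw [hb]
      nth_rw 1 [← e₂]
      simp [ht]
    · rw [h.joined_series hm hs ht, e₁, e₂, ← hc₁, ← hc₂, ← hkS]
      simp [and_assoc]
    · rw [keyn hS, e₁, e₂, ← hn₁, ← hn₂, ← hkS, Bool.or_eq_true, Bool.or_eq_true]
    · rw [key hS hkS, e₁, e₂]

theorem inter_deleteVerts (S : Set α) :
    V(G₁.deleteVerts (S ∩ V(G₁))) ∩ V(G₂.deleteVerts (S ∩ V(G₂))) = (V(G₁) ∩ V(G₂)) \ S := by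
  ext x
  simp only [vertexSet_deleteVerts, mem_inter_iff, mem_sdiff]
  tauto

theorem numComponents_parallel (h : G.IsJoin G₁ G₂) (hW : V(G₁) ∩ V(G₂) = {s, t}) (hst : s ≠ t)
    (hf₁ : V(G₁).Finite) (hf₂ : V(G₂).Finite) (S : Set α) {a b c₁ c₂ : Bool}
    (ha : a = true ↔ s ∈ S) (hb : b = true ↔ t ∈ S)
    (hc₁ : c₁ = true ↔ s ∉ S ∧ t ∉ S ∧ (G₁.deleteVerts (S ∩ V(G₁))).Joined s t)
    (hc₂ : c₂ = true ↔ s ∉ S ∧ t ∉ S ∧ (G₂.deleteVerts (S ∩ V(G₂))).Joined s t) :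
    ((G.deleteVerts S).numComponents : ℤ) = (G₁.deleteVerts (S ∩ V(G₁))).numComponents +
      (G₂.deleteVerts (S ∩ V(G₂))).numComponents - parLoss a b c₁ c₂ := by
  have h' := h.deleteVerts S
  have hI := inter_deleteVerts (G₁ := G₁) (G₂ := G₂) S
  rw [hW] at hI
  cases a <;> cases b <;> simp only [Bool.false_eq_true, false_iff, true_iff] at ha hb
  · have hI' : ({s, t} : Set α) \ S = {s, t} := by
      rw [sdiff_eq_left, Set.disjoint_left]
      rintro x (rfl | rfl) <;> assumption
    rw [hI'] at hI
    obtain ⟨k₁, k₂⟩ := h'.numComponents_of_inter_eq_pair hf₁.sdiff hf₂.sdiff hst hI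
    simp only [ha, hb, not_false_eq_true, true_and] at hc₁ hc₂
    rw [← hc₁, ← hc₂] at k₁ k₂
    cases c₁ <;> cases c₂ <;> simp [parLoss] at * <;> omega
  · have hI' : ({s, t} : Set α) \ S = {s} := by
      ext x
      simp only [mem_sdiff, mem_insert_iff, mem_singleton_iff]
      grind
    rw [hI'] at hI
    have := h'.numComponents_of_inter_eq_singleton hf₁.sdiff hf₂.sdiff hI
    simp [parLoss]
    omega
  · have hI' : ({s, t} : Set α) \ S = {t} := by
      ext x
      simp only [mem_sdiff, mem_insert_iff, mem_singleton_iff]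
      grind
    rw [hI'] at hI
    have := h'.numComponents_of_inter_eq_singleton hf₁.sdiff hf₂.sdiff hI
    simp [parLoss]
    omega
  · have hI' : ({s, t} : Set α) \ S = ∅ := by
      ext x
      simp only [mem_sdiff, mem_insert_iff, mem_singleton_iff, mem_empty_iff_false]
      grind
    rw [hI'] at hI
    have := h'.numComponents_of_disjoint hf₁.sdiff hf₂.sdiff fun w h₁ h₂ ↦ by
      have : w ∈ (∅ : Set α) := hI ▸ ⟨h₁, h₂⟩
      exact this
    simp [parLoss]
    omega

theorem joined_parallel (h : G.IsJoin G₁ G₂) (hW : V(G₁) ∩ V(G₂) = {s, t}) (S : Set α) :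
    (s ∉ S ∧ t ∉ S ∧ (G.deleteVerts S).Joined s t) ↔
      (s ∉ S ∧ t ∉ S ∧ (G₁.deleteVerts (S ∩ V(G₁))).Joined s t) ∨
      (s ∉ S ∧ t ∉ S ∧ (G₂.deleteVerts (S ∩ V(G₂))).Joined s t) := by
  rw [← and_or_left, ← and_or_left]
  refine and_congr_right fun hs ↦ and_congr_right fun ht ↦ ?_
  refine (h.deleteVerts S).joined_of_inter_eq_pair ?_
  rw [inter_deleteVerts, hW, sdiff_eq_left, Set.disjoint_left]
  rintro x (rfl | rfl) <;> assumption

theorem sdiff_parallel (h : G.IsJoin G₁ G₂) {S : Set α} (hS : S ⊆ V(G)) :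
    S \ {s, t} = (S ∩ V(G₁)) \ {s, t} ∪ (S ∩ V(G₂)) \ {s, t} := by
  rw [← union_sdiff_distrib, ← inter_union_distrib_left, ← h.vertexSet_eq, inter_eq_left.2 hS]

theorem profile_parallel (h : G.IsJoin G₁ G₂) (hW : V(G₁) ∩ V(G₂) = {s, t}) (hst : s ≠ t)
    (hf₁ : V(G₁).Finite) (hf₂ : V(G₂).Finite) :
    G.profile s t = (G₁.profile s t).parallel (G₂.profile s t) := by
  have hs : s ∈ V(G₁) ∩ V(G₂) := hW ▸ .inl rfl
  have ht : t ∈ V(G₁) ∩ V(G₂) := hW ▸ .inr rfl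
  have card : ∀ {S}, S ⊆ V(G) → (S \ {s, t}).ncard =
      ((S ∩ V(G₁)) \ {s, t}).ncard + ((S ∩ V(G₂)) \ {s, t}).ncard := by
    intro S hS
    rw [h.sdiff_parallel hS, ncard_union_eq ?_ (hf₁.inter_of_right S).sdiff
      (hf₂.inter_of_right S).sdiff]
    rw [Set.disjoint_left]
    rintro x ⟨⟨_, h₁⟩, h₂⟩ ⟨⟨_, h₃⟩, _⟩
    exact h₂ (hW ▸ ⟨h₁, h₃⟩)
  funext a b c n v
  refine propext ⟨?_, ?_⟩
  · rintro ⟨S, hS, ha, hb, hc, hn, rfl⟩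
    obtain ⟨a₁, b₁, c₁, n₁, v₁, hp₁, ha₁, hb₁, hc₁, hn₁, rfl⟩ :=
      exists_profile G₁ s t (S := S ∩ V(G₁)) inter_subset_right
    obtain ⟨a₂, b₂, c₂, n₂, v₂, hp₂, ha₂, hb₂, hc₂, hn₂, rfl⟩ :=
      exists_profile G₂ s t (S := S ∩ V(G₂)) inter_subset_right
    simp only [mem_inter_iff, hs.1, hs.2, ht.1, ht.2, and_true] at ha₁ ha₂ hb₁ hb₂ hc₁ hc₂
    obtain rfl : a = a₁ := Bool.eq_iff_iff.2 (ha.trans ha₁.symm)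
    obtain rfl : a = a₂ := Bool.eq_iff_iff.2 (ha.trans ha₂.symm)
    obtain rfl : b = b₁ := Bool.eq_iff_iff.2 (hb.trans hb₁.symm)
    obtain rfl : b = b₂ := Bool.eq_iff_iff.2 (hb.trans hb₂.symm)
    refine ⟨c₁, n₁, _, c₂, n₂, _, hp₁, hp₂, Bool.eq_iff_iff.2 ?_, Bool.eq_iff_iff.2 ?_, ?_⟩
    · rw [hc, h.joined_parallel hW, ← hc₁, ← hc₂, Bool.or_eq_true]
    · rw [hn, h.sdiff_parallel hS, union_nonempty, ← hn₁, ← hn₂, Bool.or_eq_true]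
    · rw [h.numComponents_parallel hW hst hf₁ hf₂ S ha hb hc₁ hc₂, card hS]
      push_cast
      ring
  · rintro ⟨c₁, n₁, _, c₂, n₂, _, ⟨S₁, hS₁, ha₁, hb₁, hc₁, hn₁, rfl⟩,
      ⟨S₂, hS₂, ha₂, hb₂, hc₂, hn₂, rfl⟩, rfl, rfl, rfl⟩
    have hS : S₁ ∪ S₂ ⊆ V(G) := h.vertexSet_eq ▸ union_subset_union hS₁ hS₂
    have hW' : ∀ {x}, x ∈ V(G₁) → x ∈ V(G₂) → (x ∈ S₁ ↔ x ∈ S₂) := by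
      intro x h₁ h₂
      have : x ∈ ({s, t} : Set α) := hW ▸ ⟨h₁, h₂⟩
      rcases this with rfl | rfl
      exacts [ha₁.symm.trans ha₂, hb₁.symm.trans hb₂]
    have e₁ : (S₁ ∪ S₂) ∩ V(G₁) = S₁ := by
      ext x
      exact ⟨fun ⟨hx, hx'⟩ ↦ hx.elim id fun hx ↦ (hW' hx' (hS₂ hx)).2 hx,
        fun hx ↦ ⟨.inl hx, hS₁ hx⟩⟩
    have e₂ : (S₁ ∪ S₂) ∩ V(G₂) = S₂ := by
      ext x
      exact ⟨fun ⟨hx, hx'⟩ ↦ hx.elim (fun hx ↦ (hW' (hS₁ hx) hx').1 hx) id,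
        fun hx ↦ ⟨.inr hx, hS₂ hx⟩⟩
    have ha : a = true ↔ s ∈ S₁ ∪ S₂ := by rw [mem_union, ← ha₁, ← ha₂, or_self]
    have hb : b = true ↔ t ∈ S₁ ∪ S₂ := by rw [mem_union, ← hb₁, ← hb₂, or_self]
    have hc₁' : c₁ = true ↔ s ∉ S₁ ∪ S₂ ∧ t ∉ S₁ ∪ S₂ ∧
        (G₁.deleteVerts ((S₁ ∪ S₂) ∩ V(G₁))).Joined s t := by
      rw [e₁, hc₁, ← ha, ← hb, ← ha₁, ← hb₁]
    have hc₂' : c₂ = true ↔ s ∉ S₁ ∪ S₂ ∧ t ∉ S₁ ∪ S₂ ∧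
        (G₂.deleteVerts ((S₁ ∪ S₂) ∩ V(G₂))).Joined s t := by
      rw [e₂, hc₂, ← ha, ← hb, ← ha₂, ← hb₂]
    refine ⟨S₁ ∪ S₂, hS, ha, hb, ?_, ?_, ?_⟩
    · rw [h.joined_parallel hW, ← hc₁', ← hc₂', Bool.or_eq_true]
    · rw [h.sdiff_parallel hS, e₁, e₂, union_nonempty, ← hn₁, ← hn₂, Bool.or_eq_true]
    · rw [h.numComponents_parallel hW hst hf₁ hf₂ _ ha hb hc₁' hc₂', card hS, e₁, e₂]
      push_cast
      ring

end IsJoin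

/-! ### Graphs with two vertices -/

theorem deleteVerts_adj (G : Graph α β) (S : Set α) (x y : α) :
    (G.deleteVerts S).Adj x y ↔ G.Adj x y ∧ x ∉ S ∧ y ∉ S := by
  simp [Adj]

theorem Joined.eq_or_adj {x y : α} (h : G.Joined x y) : x = y ∨ ∃ z, G.Adj x z := by
  rcases h.cases_head with h | ⟨z, h, _⟩
  exacts [.inl h, .inr ⟨z, h⟩]

/-- A profile with at most one entry for each choice of deleted terminals is the profile of `G` as
soon as it contains the latter. -/
theorem profile_eq_of_le (hs : s ∈ V(G)) (ht : t ∈ V(G)) (hst : s ≠ t) {P : Profile}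
    (h : ∀ a b c n v, G.profile s t a b c n v → P a b c n v)
    (hP : ∀ a b c n v c' n' v', P a b c n v → P a b c' n' v' → c = c' ∧ n = n' ∧ v = v') :
    G.profile s t = P := by
  funext a b c n v
  refine propext ⟨h a b c n v, fun h' ↦ ?_⟩
  have hS : {x | x = s ∧ a = true ∨ x = t ∧ b = true} ⊆ V(G) := by
    rintro x (⟨rfl, _⟩ | ⟨rfl, _⟩) <;> assumption
  obtain ⟨a', b', c', n', v', hp, ha, hb, -⟩ := exists_profile G s t hS
  obtain rfl : a' = a := Bool.eq_iff_iff.2 (ha.trans (by simp [hst]))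
  obtain rfl : b' = b := Bool.eq_iff_iff.2 (hb.trans (by simp [hst.symm]))
  obtain ⟨rfl, rfl, rfl⟩ := hP _ _ _ _ _ _ _ _ h' (h _ _ _ _ _ hp)
  exact hp

theorem pair_sdiff {S : Set α} {a b : Bool} (ha : a = true ↔ s ∈ S)
    (hb : b = true ↔ t ∈ S) :
    ({s, t} \ S : Set α) = if a then (if b then ∅ else {t}) else if b then {s} else {s, t} := by
  ext x
  cases a <;> cases b <;> simp at ha hb ⊢ <;> grind

theorem profile_eq_single (hV : V(G) = {s, t}) (hst : s ≠ t) (hadj : G.Adj s t) :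
    G.profile s t = single := by
  refine profile_eq_of_le (hV ▸ .inl rfl) (hV ▸ .inr rfl) hst ?_ ?_
  · rintro a b c n v ⟨S, hS, ha, hb, hc, hn, rfl⟩
    rw [hV] at hS
    have h₀ : S \ {s, t} = ∅ := sdiff_eq_empty.2 hS
    rw [h₀] at hn
    have hV' : V(G.deleteVerts S) = {s, t} \ S := by rw [vertexSet_deleteVerts, hV]
    rw [pair_sdiff ha hb] at hV'
    refine ⟨by simpa using hn, ?_, ?_⟩
    · cases a <;> cases b <;> simp only [Bool.false_eq_true, false_iff, true_iff] at ha hb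
      · exact hc.2 ⟨ha, hb, .single ((deleteVerts_adj _ _ _ _).2 ⟨hadj, ha, hb⟩)⟩
      all_goals simpa [ha, hb] using hc
    · rw [h₀, ncard_empty]
      cases a <;> cases b <;> simp only [Bool.false_eq_true, false_iff, true_iff] at ha hb
      · rw [numComponents_eq_one _ (by rw [hV']; exact ⟨s, .inl rfl⟩)]
        · simp
        · have hj : (G.deleteVerts S).Adj s t := (deleteVerts_adj _ _ _ _).2 ⟨hadj, ha, hb⟩
          rw [hV']
          rintro x (rfl | rfl) y (rfl | rfl)
          exacts [.refl, .single hj, .single hj.symm, .refl]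
      · rw [numComponents_eq_one _ (by rw [hV']; exact ⟨s, rfl⟩)]
        · simp
        · rw [hV']
          rintro x rfl y rfl
          exact .refl
      · rw [numComponents_eq_one _ (by rw [hV']; exact ⟨t, rfl⟩)]
        · simp
        · rw [hV']
          rintro x rfl y rfl
          exact .refl
      · have := numComponents_le_ncard (G.deleteVerts S) (by rw [hV']; exact finite_empty)
        rw [hV'] at this
        simp at this ⊢
        exact this
  · rintro a b c n v c' n' v' ⟨rfl, rfl, rfl⟩ ⟨rfl, rfl, rfl⟩
    exact ⟨rfl, rfl, rfl⟩

theorem profile_eq_isolated (hV : V(G) = {s, t}) (hst : s ≠ t) (hadj : ∀ x y, ¬ G.Adj x y) :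
    G.profile s t = isolated := by
  refine profile_eq_of_le (hV ▸ .inl rfl) (hV ▸ .inr rfl) hst ?_ ?_
  · rintro a b c n v ⟨S, hS, ha, hb, hc, hn, rfl⟩
    rw [hV] at hS
    have h₀ : S \ {s, t} = ∅ := sdiff_eq_empty.2 hS
    rw [h₀] at hn
    have hV' : V(G.deleteVerts S) = {s, t} \ S := by rw [vertexSet_deleteVerts, hV]
    rw [pair_sdiff ha hb] at hV'
    have hadj' : ∀ x y, ¬ (G.deleteVerts S).Adj x y :=
      fun x y h ↦ hadj x y ((deleteVerts_adj _ _ _ _).1 h).1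
    refine ⟨by simpa using hn, ?_, ?_⟩
    · rw [← Bool.not_eq_true, hc]
      rintro ⟨_, _, h⟩
      rcases h.eq_or_adj with h | ⟨z, h⟩
      exacts [hst h, hadj' _ _ h]
    · rw [h₀, ncard_empty, numComponents_eq_ncard _ hadj', hV']
      cases a <;> cases b <;> simp [ncard_pair hst]
  · rintro a b c n v c' n' v' ⟨rfl, rfl, rfl⟩ ⟨rfl, rfl, rfl⟩
    exact ⟨rfl, rfl, rfl⟩

/-! ### Decomposition trees of series-parallel graphs -/

theorem IsEdgeDisjointUnion.isJoin (h : IsEdgeDisjointUnion G G₁ G₂) : G.IsJoin G₁ G₂ :=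
  ⟨h.vertexSet_eq, fun x y ↦ by simp only [Adj, h.isLink_iff, exists_or]⟩

theorem IsEdgeDisjointUnion.symm (h : IsEdgeDisjointUnion G G₁ G₂) :
    IsEdgeDisjointUnion G G₂ G₁ :=
  ⟨h.vertexSet_eq.trans (union_comm _ _), h.disjoint_edgeSet.symm,
    fun e x y ↦ (h.isLink_iff e x y).trans or_comm⟩

theorem IsEdgeDisjointUnion.edgeSet_eq (h : IsEdgeDisjointUnion G G₁ G₂) :
    E(G) = E(G₁) ∪ E(G₂) := by
  ext e
  simp only [mem_union, edge_mem_iff_exists_isLink, h.isLink_iff, exists_or]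

theorem IsEdgeDisjointUnion.deleteEdges_left (h : IsEdgeDisjointUnion G G₁ G₂) {e : β}
    (he : e ∈ E(G₁)) : (G.deleteEdges {e}).IsJoin (G₁.deleteEdges {e}) G₂ := by
  refine ⟨h.vertexSet_eq, fun x y ↦ ?_⟩
  simp only [Adj, deleteEdges_isLink, h.isLink_iff, mem_singleton_iff, ← exists_or]
  refine exists_congr fun f ↦ ?_
  have : G₂.IsLink f x y → f ≠ e := by
    rintro h' rfl
    exact Set.disjoint_left.1 h.disjoint_edgeSet he h'.edge_mem
  tauto

theorem IsJoin.symm (h : G.IsJoin G₁ G₂) : G.IsJoin G₂ G₁ :=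
  ⟨h.vertexSet_eq.trans (union_comm _ _), fun x y ↦ (h.adj_iff x y).trans or_comm⟩

theorem IsEdgeDisjointUnion.deleteEdges_right (h : IsEdgeDisjointUnion G G₁ G₂) {e : β}
    (he : e ∈ E(G₂)) : (G.deleteEdges {e}).IsJoin G₁ (G₂.deleteEdges {e}) :=
  (h.symm.deleteEdges_left he).symm

/-- Vertices outside `G₂` keep their degree when `G₂` is glued on. -/
theorem IsEdgeDisjointUnion.degree_eq (h : IsEdgeDisjointUnion G G₁ G₂) {x : α}
    (hx : x ∉ V(G₂)) : G.degree x = G₁.degree x := by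
  have h₁ : ∀ e y, G.IsLink e x y ↔ G₁.IsLink e x y := fun e y ↦
    (h.isLink_iff e x y).trans (or_iff_left fun h' ↦ hx h'.left_mem)
  have h₂ : G.incidenceSet x = G₁.incidenceSet x := by
    ext e
    exact exists_congr fun y ↦ h₁ e y
  have h₃ : G.loopSet x = G₁.loopSet x := by
    ext e
    exact h₁ e x
  rw [degree, degree, h₂, h₃]

namespace IsSeriesParallelWith

theorem basic (h : G.IsSeriesParallelWith s t) :
    s ≠ t ∧ s ∈ V(G) ∧ t ∈ V(G) ∧ V(G).Finite := by
  induction h with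
  | edge e s t hst => exact ⟨hst, .inl rfl, .inr rfl, (finite_singleton t).insert s⟩
  | series G G₁ G₂ s m t _ _ hV hG h₁ h₂ =>
    refine ⟨?_, hG.vertexSet_eq ▸ .inl h₁.2.1, hG.vertexSet_eq ▸ .inr h₂.2.2.1,
      hG.vertexSet_eq ▸ h₁.2.2.2.union h₂.2.2.2⟩
    rintro rfl
    have : s ∈ ({m} : Set α) := hV ▸ ⟨h₁.2.1, h₂.2.2.1⟩
    exact h₁.1 this
  | parallel G G₁ G₂ s t _ _ hV hG h₁ h₂ =>
    exact ⟨h₁.1, hG.vertexSet_eq ▸ .inl h₁.2.1, hG.vertexSet_eq ▸ .inl h₁.2.2.1,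
      hG.vertexSet_eq ▸ h₁.2.2.2.union h₂.2.2.2⟩

theorem degree_banana {e : β} (hst : s ≠ t) : (banana s t {e}).degree s = 1 := by
  have h₁ : (banana s t {e}).incidenceSet s = {e} := by
    ext f
    simp
  have h₂ : (banana s t {e}).loopSet s = ∅ := by
    ext f
    simp [hst]
  rw [degree, h₁, h₂]
  simp

/-- A decomposition tree describes the profile of the graph and, for each of its leaves, the
profile of the graph without the corresponding edge. -/
theorem exists_tree (h : G.IsSeriesParallelWith s t) :
    ∃ T : SPTree, G.profile s t = T.profile ∧
      (∀ P, T.OneDel P → ∃ e ∈ E(G), (G.deleteEdges {e}).profile s t = P) ∧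
      (T.LeftEdge → G.degree s = 1) := by
  induction h with
  | edge e s t hst =>
    refine ⟨.edge, ?_, ?_, fun _ ↦ degree_banana hst⟩
    · exact profile_eq_single rfl hst ⟨e, by simp⟩
    · rintro _ ⟨⟩
      refine ⟨e, rfl, profile_eq_isolated rfl hst ?_⟩
      simp [Adj]
  | series G G₁ G₂ s m t hsp₁ hsp₂ hV hG h₁ h₂ =>
    obtain ⟨T₁, hT₁, hd₁, hl₁⟩ := h₁
    obtain ⟨T₂, hT₂, hd₂, hl₂⟩ := h₂
    obtain ⟨hsm, hs, hm₁, hf₁⟩ := hsp₁.basic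
    obtain ⟨hmt, hm₂, ht, hf₂⟩ := hsp₂.basic
    refine ⟨.series T₁ T₂, ?_, ?_, fun hl ↦ ?_⟩
    · rw [hG.isJoin.profile_series hV hs ht hsm hmt hf₁ hf₂, hT₁, hT₂]
      rfl
    · rintro _ (_ | ⟨_, _, P, hP⟩ | ⟨_, _, P, hP⟩)
      · obtain ⟨e, he, rfl⟩ := hd₁ P hP
        refine ⟨e, hG.edgeSet_eq ▸ .inl he, ?_⟩
        rw [(hG.deleteEdges_left he).profile_series hV hs ht hsm hmt hf₁ hf₂, hT₂]
      · obtain ⟨e, he, rfl⟩ := hd₂ P hP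
        refine ⟨e, hG.edgeSet_eq ▸ .inr he, ?_⟩
        rw [(hG.deleteEdges_right he).profile_series hV hs ht hsm hmt hf₁ hf₂, hT₁]
    · rw [hG.degree_eq, hl₁ hl]
      intro hs'
      have : s ∈ ({m} : Set α) := hV ▸ ⟨hs, hs'⟩
      exact hsm this
  | parallel G G₁ G₂ s t hsp₁ hsp₂ hV hG h₁ h₂ =>
    obtain ⟨T₁, hT₁, hd₁, hl₁⟩ := h₁
    obtain ⟨T₂, hT₂, hd₂, hl₂⟩ := h₂
    obtain ⟨hst, hs, ht, hf₁⟩ := hsp₁.basic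
    obtain ⟨_, _, _, hf₂⟩ := hsp₂.basic
    refine ⟨.parallel T₁ T₂, ?_, ?_, fun hl ↦ hl.elim⟩
    · rw [hG.isJoin.profile_parallel hV hst hf₁ hf₂, hT₁, hT₂]
      rfl
    · rintro _ (_ | _ | _ | ⟨_, _, P, hP⟩ | ⟨_, _, P, hP⟩)
      · obtain ⟨e, he, rfl⟩ := hd₁ P hP
        refine ⟨e, hG.edgeSet_eq ▸ .inl he, ?_⟩
        rw [(hG.deleteEdges_left he).profile_parallel hV hst hf₁ hf₂, hT₂]
      · obtain ⟨e, he, rfl⟩ := hd₂ P hP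
        refine ⟨e, hG.edgeSet_eq ▸ .inr he, ?_⟩
        rw [(hG.deleteEdges_right he).profile_parallel hV hst hf₁ hf₂, hT₁]

/-! ### A vertex of degree two -/

/-- `v` is a vertex of degree `2` that is not a terminal, and its neighbours are among two other
vertices. -/
def IsInnerDegreeTwo (G : Graph α β) (s t v : α) : Prop :=
  v ∈ V(G) ∧ v ≠ s ∧ v ≠ t ∧ G.degree v = 2 ∧
    ∃ x ∈ V(G), ∃ y ∈ V(G), x ≠ v ∧ y ≠ v ∧ ∀ z, G.Adj v z → z = x ∨ z = y

theorem IsInnerDegreeTwo.of_left {v p q : α} (hG : IsEdgeDisjointUnion G G₁ G₂)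
    (h : IsInnerDegreeTwo G₁ p q v) (hv : v ∉ V(G₂)) (hvs : v ≠ s) (hvt : v ≠ t) :
    IsInnerDegreeTwo G s t v := by
  obtain ⟨hv₁, -, -, hd, x, hx, y, hy, hxv, hyv, hN⟩ := h
  refine ⟨hG.vertexSet_eq ▸ .inl hv₁, hvs, hvt, (hG.degree_eq hv).trans hd, x,
    hG.vertexSet_eq ▸ .inl hx, y, hG.vertexSet_eq ▸ .inl hy, hxv, hyv, fun z hz ↦ hN z ?_⟩
  exact ((hG.isJoin.adj_iff _ _).1 hz).resolve_right fun h ↦ hv h.left_mem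

/-- A series-parallel graph is a single edge, or has parallel edges, or has an inner vertex of
degree `2`: consider an innermost join, whose parts are edges. -/
theorem exists_isInnerDegreeTwo (h : G.IsSeriesParallelWith s t) :
    (∃ e, G = banana s t {e}) ∨ (∃ e f x y, e ≠ f ∧ G.IsLink e x y ∧ G.IsLink f x y) ∨
      ∃ v, IsInnerDegreeTwo G s t v := by
  induction h with
  | edge e s t hst => exact .inl ⟨e, rfl⟩
  | series G G₁ G₂ s m t hsp₁ hsp₂ hV hG h₁ h₂ =>
    obtain ⟨hsm, hs, hm₁, -⟩ := hsp₁.basic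
    obtain ⟨hmt, hm₂, ht, -⟩ := hsp₂.basic
    have hV' : ∀ {x}, x ∈ V(G₁) → x ∈ V(G₂) → x = m := fun h₁ h₂ ↦
      (hV ▸ ⟨h₁, h₂⟩ : _ ∈ ({m} : Set α))
    rcases h₁ with ⟨e, he⟩ | ⟨e, f, x, y, hef, h₁, h₂⟩ | ⟨v, hv⟩
    · rcases h₂ with ⟨f, hf⟩ | ⟨e, f, x, y, hef, h₁, h₂⟩ | ⟨v, hv⟩
      · have hlink : ∀ g x, G.IsLink g m x ↔ g = e ∧ x = s ∨ g = f ∧ x = t := by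
          intro g x
          rw [hG.isLink_iff, he, hf]
          simp [hsm.symm, hmt]
        have hef : e ≠ f := by
          rintro rfl
          exact Set.disjoint_left.1 hG.disjoint_edgeSet (by rw [he]; rfl : e ∈ E(G₁))
            (by rw [hf]; rfl)
        have k₁ : G.incidenceSet m = {e, f} := by
          ext g
          simp only [mem_incidenceSet, Inc, hlink, mem_insert_iff, mem_singleton_iff]
          simp [exists_or]
        have k₂ : G.loopSet m = ∅ := by
          ext g
          simp only [mem_loopSet, ← isLink_self_iff, hlink, mem_empty_iff_false]
          simp [hsm.symm, hmt]
        refine .inr (.inr ⟨m, hG.vertexSet_eq ▸ .inl hm₁, hsm.symm, hmt, ?_, s,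
          hG.vertexSet_eq ▸ .inl hs, t, hG.vertexSet_eq ▸ .inr ht, hsm, hmt.symm, ?_⟩)
        · rw [degree, k₁, k₂, ncard_pair hef, ncard_empty]
        · rintro z ⟨g, hg⟩
          exact ((hlink g z).1 hg).imp And.right And.right
      · exact .inr (.inl ⟨e, f, x, y, hef, (hG.isLink_iff _ _ _).2 (.inr h₁),
          (hG.isLink_iff _ _ _).2 (.inr h₂)⟩)
      · have hv₁ : v ∉ V(G₁) := fun h ↦ hv.2.1 (hV' h hv.1)
        exact .inr (.inr ⟨v, hv.of_left hG.symm hv₁ (fun h ↦ hv₁ (h ▸ hs)) hv.2.2.1⟩)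
    · exact .inr (.inl ⟨e, f, x, y, hef, (hG.isLink_iff _ _ _).2 (.inl h₁),
        (hG.isLink_iff _ _ _).2 (.inl h₂)⟩)
    · have hv₂ : v ∉ V(G₂) := fun h ↦ hv.2.2.1 (hV' hv.1 h)
      exact .inr (.inr ⟨v, hv.of_left hG hv₂ hv.2.1 (fun h ↦ hv₂ (h ▸ ht))⟩)
  | parallel G G₁ G₂ s t hsp₁ hsp₂ hV hG h₁ h₂ =>
    have hV' : ∀ {x}, x ∈ V(G₁) → x ∈ V(G₂) → x = s ∨ x = t := fun h₁ h₂ ↦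
      (hV ▸ ⟨h₁, h₂⟩ : _ ∈ ({s, t} : Set α))
    rcases h₁ with ⟨e, he⟩ | ⟨e, f, x, y, hef, h₁, h₂⟩ | ⟨v, hv⟩
    · rcases h₂ with ⟨f, hf⟩ | ⟨e, f, x, y, hef, h₁, h₂⟩ | ⟨v, hv⟩
      · have hef : e ≠ f := by
          rintro rfl
          exact Set.disjoint_left.1 hG.disjoint_edgeSet (by rw [he]; rfl : e ∈ E(G₁))
            (by rw [hf]; rfl)
        refine .inr (.inl ⟨e, f, s, t, hef, (hG.isLink_iff _ _ _).2 (.inl ?_),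
          (hG.isLink_iff _ _ _).2 (.inr ?_)⟩)
        · simp [he]
        · simp [hf]
      · exact .inr (.inl ⟨e, f, x, y, hef, (hG.isLink_iff _ _ _).2 (.inr h₁),
          (hG.isLink_iff _ _ _).2 (.inr h₂)⟩)
      · have hv₁ : v ∉ V(G₁) := fun h ↦ (hV' h hv.1).elim hv.2.1 hv.2.2.1
        exact .inr (.inr ⟨v, hv.of_left hG.symm hv₁ hv.2.1 hv.2.2.1⟩)
    · exact .inr (.inl ⟨e, f, x, y, hef, (hG.isLink_iff _ _ _).2 (.inl h₁),
        (hG.isLink_iff _ _ _).2 (.inl h₂)⟩)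
    · have hv₂ : v ∉ V(G₂) := fun h ↦ (hV' hv.1 h).elim hv.2.1 hv.2.2.1
      exact .inr (.inr ⟨v, hv.of_left hG hv₂ hv.2.1 hv.2.2.1⟩)

end IsSeriesParallelWith

/-! ### Toughness -/

/-- The supremum in the definition of the toughness is attained. -/
theorem isTough_of_toughness_eq {r : ℝ} (h : G.toughness = (r : EReal)) : G.IsTough r := by
  intro S hS hc
  have hc' : (0 : ℝ) < (G.deleteVerts S).numComponents := by
    exact_mod_cast (zero_lt_one.trans hc)
  rw [← le_div_iff₀ hc', ← EReal.coe_le_coe_iff, ← h]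
  refine sSup_le ?_
  rintro _ ⟨q, rfl, hq⟩
  rw [EReal.coe_le_coe_iff, le_div_iff₀ hc']
  exact hq S hS hc

theorem not_isTough_of_toughness_lt {r : ℝ} (h : G.toughness < (r : EReal)) : ¬ G.IsTough r :=
  fun h' ↦ h.not_ge (le_sSup ⟨r, rfl, h'⟩)

theorem exists_one_lt_of_toughness_eq {r : ℝ} (h : G.toughness = (r : EReal)) :
    ∃ S ⊆ V(G), 1 < (G.deleteVerts S).numComponents := by
  by_contra! hn
  have : ((r + 1 : ℝ) : EReal) ≤ r :=
    h ▸ le_sSup ⟨r + 1, rfl, fun S hS hc ↦ absurd hc (hn S hS).not_gt⟩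
  rw [EReal.coe_le_coe_iff] at this
  linarith

/-- Deleting one of two parallel edges does not change the toughness. -/
theorem toughness_deleteEdges_of_parallel {e f : β} {x y : α} (hef : e ≠ f)
    (he : G.IsLink e x y) (hf : G.IsLink f x y) :
    (G.deleteEdges {e}).toughness = G.toughness := by
  have hadj : ∀ a b, (G.deleteEdges {e}).Adj a b ↔ G.Adj a b := by
    intro a b
    constructor
    · rintro ⟨g, hg⟩
      rw [deleteEdges_isLink] at hg
      exact ⟨g, hg.1⟩
    · rintro ⟨g, hg⟩
      by_cases hge : g = e
      · subst hge
        refine ⟨f, ?_⟩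
        rw [deleteEdges_isLink]
        refine ⟨?_, fun h ↦ hef h.symm⟩
        rcases he.eq_and_eq_or_eq_and_eq hg with ⟨rfl, rfl⟩ | ⟨rfl, rfl⟩
        exacts [hf, hf.symm]
      · exact ⟨g, by rw [deleteEdges_isLink]; exact ⟨hg, hge⟩⟩
  have hc : ∀ S, ((G.deleteEdges {e}).deleteVerts S).numComponents =
      (G.deleteVerts S).numComponents := by
    intro S
    refine numComponents_congr rfl fun a b ↦ ?_
    rw [deleteVerts_adj, deleteVerts_adj, hadj]
  have ht : ∀ r, (G.deleteEdges {e}).IsTough r ↔ G.IsTough r := by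
    intro r
    simp only [IsTough, hc]
    rfl
  simp only [toughness, ht]

/-- The entries of the profile, with deleted terminals charged, come from vertex sets. -/
theorem total_profile_iff (hst : s ≠ t) (hf : V(G).Finite) (n : Bool) (v : ℤ) :
    (G.profile s t).Total n v ↔ ∃ S ⊆ V(G), (n = true ↔ S.Nonempty) ∧
      v = (G.deleteVerts S).numComponents - 2 * (S.ncard : ℤ) := by
  have hn : ∀ {S : Set α} {a b n' : Bool}, (a = true ↔ s ∈ S) → (b = true ↔ t ∈ S) →
      (n' = true ↔ (S \ {s, t}).Nonempty) → ((a || b || n') = true ↔ S.Nonempty) := by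
    intro S a b n' ha hb hn'
    rw [Bool.or_eq_true, Bool.or_eq_true, ha, hb, hn']
    constructor
    · rintro ((h | h) | ⟨x, h, _⟩) <;> exact ⟨_, h⟩
    · rintro ⟨x, hx⟩
      by_cases hxs : x = s
      · exact .inl (.inl (hxs ▸ hx))
      by_cases hxt : x = t
      · exact .inl (.inr (hxt ▸ hx))
      · exact .inr ⟨x, hx, by simp [hxs, hxt]⟩
  have hcard : ∀ {S : Set α} {a b : Bool}, S ⊆ V(G) → (a = true ↔ s ∈ S) → (b = true ↔ t ∈ S) →
      (2 * (S.ncard : ℤ)) = 2 * ((S \ {s, t}).ncard : ℤ) + (if a then 2 else 0) +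
        (if b then 2 else 0) := by
    intro S a b hS ha hb
    have hSf := hf.subset hS
    have h₁ := ncard_inter_add_ncard_sdiff_eq_ncard S {s, t} hSf
    have h₂ : (S ∩ {s, t}).ncard = (if a then 1 else 0) + (if b then 1 else 0) := by
      cases a <;> cases b <;> simp only [Bool.false_eq_true, false_iff, true_iff] at ha hb
      · have : S ∩ {s, t} = ∅ := by ext; simp; grind
        simp [this]
      · have : S ∩ {s, t} = {t} := by ext; simp; grind
        simp [this]
      · have : S ∩ {s, t} = {s} := by ext; simp; grind
        simp [this]
      · have : S ∩ {s, t} = {s, t} := by ext; simp; grind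
        simp [this, ncard_pair hst]
    cases a <;> cases b <;> 
      simp only [Bool.false_eq_true, if_true, if_false] at h₂ ⊢ <;> omega
  constructor
  · rintro ⟨a, b, c, n', w, ⟨S, hS, ha, hb, hc, hn', rfl⟩, rfl, rfl⟩
    exact ⟨S, hS, hn ha hb hn', by rw [hcard hS ha hb]; ring⟩
  · rintro ⟨S, hS, hnS, rfl⟩
    obtain ⟨a, b, c, n', v, hp, ha, hb, hc, hn', rfl⟩ := exists_profile G s t hS
    exact ⟨a, b, c, n', _, hp, Bool.eq_iff_iff.2 (hnS.trans (hn ha hb hn').symm),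
      by rw [hcard hS ha hb]; ring⟩

theorem parallel_isolated (P : Profile) : P.parallel isolated = P := by
  funext a b c n v
  refine propext ⟨?_, fun h ↦ ?_⟩
  · rintro ⟨c₁, n₁, v₁, _, _, _, h₁, ⟨rfl, rfl, rfl⟩, rfl, rfl, rfl⟩
    cases a <;> cases b <;> simpa [parLoss] using h₁
  · refine ⟨c, n, v, _, _, _, h, ⟨rfl, rfl, rfl⟩, by simp, by simp, ?_⟩
    cases a <;> cases b <;> simp [parLoss]

/-- For `t = 1 / 2` the vertex of degree `⌈2t⌉ = 1` is a terminal: its single edge is the leftmost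
leaf of the decomposition tree. -/
theorem IsSeriesParallelWith.degree_eq_one (h : G.IsSeriesParallelWith s t)
    (hmin : G.IsMinimallyTough (1 / 2)) : G.degree s = 1 := by
  obtain ⟨hst, hs, ht, hf⟩ := h.basic
  obtain ⟨T, hT, hd, hl⟩ := h.exists_tree
  have htough := isTough_of_toughness_eq hmin.1
  refine hl (SPTree.leftEdge_of_crit SPTree.leftIsolated_isolated ?_ ?_)
  · intro n v hv
    rw [parallel_isolated] at hv
    refine ⟨fun hn ↦ ?_, fun hn ↦ ?_⟩
    · rw [← hT, total_profile_iff hst hf] at hv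
      obtain ⟨S, hS, hnS, rfl⟩ := hv
      have hpos := (ncard_pos (hf.subset hS)).2 (hnS.1 hn)
      by_cases hc : 1 < (G.deleteVerts S).numComponents
      · have := htough S hS hc
        have h₂ : ((G.deleteVerts S).numComponents : ℝ) ≤ 2 * (S.ncard : ℝ) := by linarith
        have h₃ : (G.deleteVerts S).numComponents ≤ 2 * S.ncard := by exact_mod_cast h₂
        omega
      · omega
    · obtain ⟨a, b, c, n', w, hp, rfl, rfl⟩ := hv
      simp only [Bool.or_eq_false_iff] at hn
      obtain ⟨⟨rfl, rfl⟩, rfl⟩ := hn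
      simp [(T.profile_of_empty hp).2]
  · intro P hP
    obtain ⟨e, he, rfl⟩ := hd P hP
    have hnt := not_isTough_of_toughness_lt (hmin.2 e he)
    simp only [IsTough, not_forall, not_le] at hnt
    obtain ⟨S, hS, hc, hlt⟩ := hnt
    obtain ⟨n, hn⟩ := exists_bool_iff S.Nonempty
    have h₂ : 2 * (S.ncard : ℝ) < (((G.deleteEdges {e}).deleteVerts S).numComponents : ℝ) := by
      linarith
    have h₃ : 2 * S.ncard < ((G.deleteEdges {e}).deleteVerts S).numComponents := by
      exact_mod_cast h₂
    rw [parallel_isolated]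
    refine ⟨n, _, (total_profile_iff (G := G.deleteEdges {e}) hst hf _ _).2
      ⟨S, hS, hn, rfl⟩, ?_, ?_⟩
    · omega
    · rintro rfl
      have : S = ∅ := by simpa [not_nonempty_iff_eq_empty] using hn
      rw [this, ncard_empty] at h₃ ⊢
      rw [this] at hc
      omega

/-- For `t > 1 / 2` an inner vertex of degree `2` has the right degree, and deleting its
neighbours bounds the toughness by `1`. -/
theorem IsSeriesParallelWith.le_one_and_exists (h : G.IsSeriesParallelWith s t) {r : ℝ}
    (hr : 1 / 2 < r) (hmin : G.IsMinimallyTough r) : r ≤ 1 ∧ ∃ v ∈ V(G), G.degree v = 2 := by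
  obtain ⟨hst, hs, ht, hf⟩ := h.basic
  have htough := isTough_of_toughness_eq hmin.1
  have hfour : 4 ≤ V(G).ncard := by
    obtain ⟨S, hS, hc⟩ := exists_one_lt_of_toughness_eq hmin.1
    have h₁ := htough S hS hc
    have h₂ : (2 : ℝ) ≤ (G.deleteVerts S).numComponents := by exact_mod_cast hc
    have h₃ : (1 : ℝ) < S.ncard := by nlinarith
    have h₄ : 1 < S.ncard := by exact_mod_cast h₃
    have h₅ := numComponents_le_ncard (G.deleteVerts S) hf.sdiff
    rw [vertexSet_deleteVerts] at h₅
    have := ncard_sdiff_add_ncard_of_subset hS hf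
    omega
  rcases h.exists_isInnerDegreeTwo with ⟨e, rfl⟩ | ⟨e, f, x, y, hef, he, hf'⟩ |
    ⟨v, hv, -, -, hd, x, hx, y, hy, hxv, hyv, hN⟩
  · have : ({s, t} : Set α).ncard ≤ 2 := (ncard_insert_le s {t}).trans (by simp)
    exact absurd (hfour.trans this) (by norm_num)
  · have := hmin.2 e he.edge_mem
    rw [toughness_deleteEdges_of_parallel hef he hf', hmin.1] at this
    exact absurd this (lt_irrefl _)
  · refine ⟨?_, v, hv, hd⟩
    have hcard : ({x, y} : Set α).ncard ≤ 2 := (ncard_insert_le x {y}).trans (by simp)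
    obtain ⟨w, hw, hw'⟩ : ∃ w ∈ V(G), w ∉ ({v, x, y} : Set α) := by
      by_contra! hn
      have h₁ := ncard_le_ncard (s := V(G)) (t := {v, x, y}) hn (by simp)
      have h₂ := ncard_insert_le v {x, y}
      omega
    have hS : ({x, y} : Set α) ⊆ V(G) := by
      rintro z (rfl | rfl) <;> assumption
    have hvS : v ∉ ({x, y} : Set α) := by
      rintro (rfl | h)
      exacts [hxv rfl, hyv h.symm]
    have hc : 1 < (G.deleteVerts {x, y}).numComponents := by
      refine one_lt_numComponents _ hf.sdiff (x := v) (y := w) ⟨hv, hvS⟩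
        ⟨hw, fun h ↦ hw' (.inr h)⟩ fun hj ↦ ?_
      rcases hj.eq_or_adj with rfl | ⟨z, hz⟩
      · exact hw' (.inl rfl)
      · rw [deleteVerts_adj] at hz
        exact hz.2.2 (hN z hz.1)
    have h₁ := htough _ hS hc
    have h₂ : (2 : ℝ) ≤ (G.deleteVerts {x, y}).numComponents := by exact_mod_cast hc
    have h₃ : (({x, y} : Set α).ncard : ℝ) ≤ 2 := by exact_mod_cast hcard
    nlinarith

end Graph

theorem mainTheorem4 {α β : Type*} (G : Graph α β) (hG : G.IsSeriesParallel)
    (t : ℝ) (ht : 1 / 2 ≤ t) (hmin : G.IsMinimallyTough t) :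
    t ≤ 1 ∧ ∃ v ∈ G.vertexSet, (G.degree v : ℤ) = ⌈2 * t⌉ := by
  obtain ⟨a, b, h⟩ := hG
  rcases ht.eq_or_lt with rfl | ht
  · refine ⟨by norm_num, a, h.basic.2.1, ?_⟩
    rw [h.degree_eq_one hmin]
    norm_num
  · obtain ⟨h₁, v, hv, hd⟩ := h.le_one_and_exists ht hmin
    refine ⟨h₁, v, hv, ?_⟩
    rw [hd, eq_comm, Int.ceil_eq_iff]
    constructor <;> push_cast <;> linarith
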